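/- Let $n\ge 1$ and $k\ge 2$, and let $\Sigma=\{0,\dots,k-1\}$ with arithmetic modulo $k$. A de Bruijn sequence of order $n$ over $\Sigma$ is a circular string of length $k^n$ in which every string of length $n$ occurs exactly once. The discrepancy of a circular string $w$ is $\max_{s}\bigl(\max_{a\in\Sigma}|s|_a-\min_{c\in\Sigma}|s|_c\bigr)$, where $s$ ranges over the substrings of $w$ and $|s|_a$ is the number of occurrences of $a$ in $s$. For $s\in\Sigma^n$ and $c\in\Sigma$ let $ICR_c(s)=s[1]\,s[2]\cdots s[n-1]\,(s[0]+c)$, and let $\Delta(s)\in\Sigma^n$ be given by $\Delta(s)[0]=s[n-1]-s[0]-1$ and $\Delta(s)[i]=s[i-1]-s[i]$ for $0<i<n$. Call $s$ admissible if, with $d=\Delta(s)$, we have $d[n-1]\neq 0$ and there is an index $0<i\le n-1$ with $d[i-1]\ne 0$ and $d[i]=\dots=d[n-2]=0$ such that the rotation $d[i]\cdots d[n-1]\,d[0]\cdots d[i-1]$ is lexicographically minimal among all rotations of $d$. For $(s,p)\in\Sigma^n\times\Sigma$ define $$T(s,p)=\begin{cases}(ICR_0(s),\,p+1)&\text{if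 } ICR_0(s)\text{ is admissible with last symbol } p+1,\\ (ICR_2(s),\,p-1)&\text{otherwise, if } ICR_1(s)\text{ is admissible with last symbol } p,\\ (ICR_1(s),\,p)&\text{otherwise.}\end{cases}$$ Let $w_{n,k}$ be the circular string of length $k^n$ whose $j$-th symbol ($0\le j<k^n$) is the last symbol of the string in $T^{\,j+1}(0^n,0)$. (This is a variant of Huang's incremented-cycle-register construction.) Theorem. 1. For all $n\ge1$, $k\ge2$, the string $w_{n,k}$ is a de Bruijn sequence of order $n$ over $\Sigma$. Its discrepancy is exactly $n$ if $k=2$, and at most $n+1$ if $k>2$. 2. There are a single word-RAM program and a constant $C$ such that for all $n\ge 1$, $k\ge 2$ the program, on input $(n,k)$, outputs the symbols of $w_{n,k}$ in order and halts, using at most $Cn$ memory cells, each holding a number below $C(n+k)$ (besides a fixed number of registers, with the same bound), and taking $O(n)$ time per output symbol: the time before the first output, between consecutive outputs, and from the last output to the halt is at most $Cn$ unit-cost steps. 3. For all $n\ge1$, $k\ge2$, every de Bruijn sequence of order $n$ over a $k$-symbol alphabet has discrepancy at least $n$. Consequently the minimum discrepancy of a binary de Bruijn sequence of order $n$ is exactly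 $n$. -/

import Mathlib

namespace DeBruijn

/-! ### Circular strings, de Bruijn sequences, discrepancy

A circular string of length `N` over `α` is a function `w : Fin N → α`. -/

section Words

variable {α : Type} [Fintype α] [DecidableEq α] {N : ℕ}

/-- The substring of length `l` of the circular string `w` that starts at position `i`. -/
def factor (w : Fin N → α) (i : Fin N) (l : ℕ) : List α :=
  List.ofFn fun j : Fin l => w ⟨(i.val + j.val) % N, Nat.mod_lt _ i.pos⟩

/-- `w` is a de Bruijn sequence of order `n`: a circular string of length `b ^ n`, where `b` is the
number of symbols, in which every string of length `n` occurs exactly once. -/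
structure IsDeBruijn (n : ℕ) (w : Fin N → α) : Prop where
  length_eq : N = Fintype.card α ^ n
  occurs_once : ∀ u : List α, u.length = n → ∃! i : Fin N, factor w i n = u

/-- The number of occurrences of the most frequent symbol of the alphabet in `s` minus that of the
least frequent one. -/
def difference [Nonempty α] (s : List α) : ℕ :=
  Finset.univ.sup' Finset.univ_nonempty (fun a : α => s.count a) -
    Finset.univ.inf' Finset.univ_nonempty (fun c : α => s.count c)

/-- The maximum of `difference` over all substrings (of length at most `N`) of the circular
string `w`. -/
def discrepancy [Nonempty α] (w : Fin N → α) : ℕ :=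
  Finset.univ.sup fun i : Fin N => (Finset.range (N + 1)).sup fun l => difference (factor w i l)

end Words

/-! ### The variant of the incremented cycle register construction

The alphabet `{0, …, k - 1}` is `ZMod k`, a string of length `n` is a function `Fin n → ZMod k`;
`i + 1` and `i - 1` in `Fin n` are cyclic. -/

section Construction

variable {n k : ℕ} [NeZero n] [NeZero k]

/-- `ICR_c (s) = s[1] s[2] … s[n-1] (s[0] + c)`. -/
def icr (c : ZMod k) (s : Fin n → ZMod k) : Fin n → ZMod k :=
  fun i => if i + 1 = 0 then s 0 + c else s (i + 1)

/-- The difference array: `Δ(s)[i] = s[i-1] - s[i]` for `0 < i`, and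
`Δ(s)[0] = s[n-1] - s[0] - 1`. -/
def diffArray (s : Fin n → ZMod k) : Fin n → ZMod k :=
  fun i => if i = 0 then s (i - 1) - s i - 1 else s (i - 1) - s i

/-- The cyclic rotation of `d` that starts at position `i`. -/
def rot (d : Fin n → ZMod k) (i : Fin n) : Fin n → ZMod k := fun j => d (j + i)

/-- `a` is lexicographically smaller than `b`, for the order `0 < 1 < … < k - 1` of the symbols. -/
def LexLT (a b : Fin n → ZMod k) : Prop :=
  ∃ m : Fin n, (∀ j : Fin n, j < m → a j = b j) ∧ (a m).val < (b m).val

/-- The last position of a string of length `n`. -/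
def lastIdx (n : ℕ) [NeZero n] : Fin n := ⟨n - 1, Nat.sub_lt (NeZero.pos n) Nat.one_pos⟩

/-- With `d = Δ(s)`: the last entry of `d` is nonzero, the run of zeros just before it (possibly of
length zero) occupies the positions `i, …, n - 2` and is preceded by a nonzero entry (so `i ≠ 0`),
and the rotation of `d` starting at `i` is lexicographically minimal among all rotations. -/
def CorrectDiffArray (s : Fin n → ZMod k) : Prop :=
  diffArray s (lastIdx n) ≠ 0 ∧
    ∃ i : Fin n, i ≠ 0 ∧ diffArray s (i - 1) ≠ 0 ∧
      (∀ j : Fin n, i ≤ j → j < lastIdx n → diffArray s j = 0) ∧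
      ∀ r : Fin n, ¬ LexLT (rot (diffArray s) r) (rot (diffArray s) i)

instance (a b : Fin n → ZMod k) : Decidable (LexLT a b) := by
  unfold LexLT; infer_instance

instance (s : Fin n → ZMod k) : Decidable (CorrectDiffArray s) := by
  unfold CorrectDiffArray; infer_instance

/-- The transition: the current string together with the current depth modulo `k`. -/
def transition (x : (Fin n → ZMod k) × ZMod k) : (Fin n → ZMod k) × ZMod k :=
  if CorrectDiffArray (icr 0 x.1) ∧ icr 0 x.1 (lastIdx n) = x.2 + 1 then
    (icr 0 x.1, x.2 + 1)
  else if CorrectDiffArray (icr 1 x.1) ∧ icr 1 x.1 (lastIdx n) = x.2 then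
    (icr 2 x.1, x.2 - 1)
  else
    (icr 1 x.1, x.2)

/-- The circular string of length `k ^ n` of the last symbols of the strings visited when the
transition is iterated, starting from `0 … 0` at depth `0`. -/
def icrWord (n k : ℕ) [NeZero n] [NeZero k] : Fin (k ^ n) → ZMod k :=
  fun j => (transition^[j.val + 1] (fun _ : Fin n => (0 : ZMod k), (0 : ZMod k))).1 (lastIdx n)

end Construction

/-! ### Programs for a word RAM, with a step count -/

/-- Comparisons of two registers. -/
inductive Test : Type
  | lt (a b : ℕ)
  | eq (a b : ℕ)
  | ne (a b : ℕ)

/-- Programs. Arguments of instructions are numbers of registers, except that `c` in `const` is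
a constant; a program mentions finitely many registers. -/
inductive Prog : Type
  | skip
  | const (r c : ℕ)
  | copy (r a : ℕ)
  | add (r a b : ℕ)
  | sub (r a b : ℕ)
  | load (r a : ℕ)
  | store (a b : ℕ)
  | output (a : ℕ)
  | seq (p q : Prog)
  | ite (t : Test) (p q : Prog)
  | while (t : Test) (p : Prog)

/-- The contents of the registers and of the memory. -/
structure State : Type where
  reg : ℕ → ℕ
  mem : ℕ → ℕ

/-- The outcome of a test. -/
def Test.Holds (s : State) : Test → Prop
  | .lt a b => s.reg a < s.reg b
  | .eq a b => s.reg a = s.reg b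
  | .ne a b => s.reg a ≠ s.reg b

/-- Write the value `v` into register `r`. -/
def State.setReg (s : State) (r v : ℕ) : State := ⟨Function.update s.reg r v, s.mem⟩

/-- Write the value `v` into the memory cell `i`. -/
def State.setMem (s : State) (i v : ℕ) : State := ⟨s.reg, Function.update s.mem i v⟩

/-- `Exec S W p s t s'`: on a machine whose memory consists of the `S` cells `0, …, S - 1` and whose
words are the numbers below `W`, the program `p` started in the state `s` halts in the state `s'`
with trace `t`. Every instruction and every evaluation of a test is one step and contributes one
entry to the trace: `some v` if the step outputs `v`, and `none` otherwise. So `t.length` is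
the running time. An access outside of the memory or a result that does not fit into a word is
a failure, after which there is no execution. Subtraction is truncated at zero. -/
inductive Exec (S W : ℕ) : Prog → State → List (Option ℕ) → State → Prop
  | skip (s : State) : Exec S W .skip s [none] s
  | const (s : State) (r c : ℕ) (h : c < W) : Exec S W (.const r c) s [none] (s.setReg r c)
  | copy (s : State) (r a : ℕ) : Exec S W (.copy r a) s [none] (s.setReg r (s.reg a))
  | add (s : State) (r a b : ℕ) (h : s.reg a + s.reg b < W) :
      Exec S W (.add r a b) s [none] (s.setReg r (s.reg a + s.reg b))
  | sub (s : State) (r a b : ℕ) :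
      Exec S W (.sub r a b) s [none] (s.setReg r (s.reg a - s.reg b))
  | load (s : State) (r a : ℕ) (h : s.reg a < S) :
      Exec S W (.load r a) s [none] (s.setReg r (s.mem (s.reg a)))
  | store (s : State) (a b : ℕ) (h : s.reg a < S) :
      Exec S W (.store a b) s [none] (s.setMem (s.reg a) (s.reg b))
  | output (s : State) (a : ℕ) : Exec S W (.output a) s [some (s.reg a)] s
  | seq {p q : Prog} {s s' s'' : State} {t t' : List (Option ℕ)}
      (hp : Exec S W p s t s') (hq : Exec S W q s' t' s'') :
      Exec S W (.seq p q) s (t ++ t') s''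
  | iteTrue {b : Test} {p : Prog} (q : Prog) {s s' : State} {t : List (Option ℕ)}
      (hb : b.Holds s) (hp : Exec S W p s t s') : Exec S W (.ite b p q) s (none :: t) s'
  | iteFalse {b : Test} (p : Prog) {q : Prog} {s s' : State} {t : List (Option ℕ)}
      (hb : ¬ b.Holds s) (hq : Exec S W q s t s') : Exec S W (.ite b p q) s (none :: t) s'
  | whileFalse {b : Test} (p : Prog) {s : State} (hb : ¬ b.Holds s) :
      Exec S W (.while b p) s [none] s
  | whileTrue {b : Test} {p : Prog} {s s' s'' : State} {t t' : List (Option ℕ)}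
      (hb : b.Holds s) (hp : Exec S W p s t s') (hw : Exec S W (.while b p) s' t' s'') :
      Exec S W (.while b p) s (none :: (t ++ t')) s''

/-- The state in which the input `(n, k)` is in the registers `0` and `1`, and everything else is
zero. -/
def inputState (n k : ℕ) : State :=
  ⟨fun r => if r = 0 then n else if r = 1 then k else 0, fun _ => 0⟩

/-- On the input `(n, k)` the program `p`, run with `S` memory cells that hold numbers below `W`,
halts, its output is the sequence `w` of symbols, and among any `T` consecutive steps (of the whole
run, from the start to the halt) there is one that outputs a symbol. -/
def Generates (p : Prog) (n k S W T : ℕ) {N : ℕ} (w : Fin N → ZMod k) : Prop :=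
  ∃ (t : List (Option ℕ)) (s : State),
    Exec S W p (inputState n k) t s ∧
    t.filterMap id = List.ofFn (fun i => (w i).val) ∧
    ∀ u : List (Option ℕ), u <:+: t → T ≤ u.length → ∃ v : ℕ, some v ∈ u

end DeBruijn

/-!
The proof views `transition` as a walk on cycles that are joined into a tree.

*The de Bruijn property.* The map `icr 1` permutes the strings. It rotates the difference array
(`diffArray_icr_one`), and two strings lie on one cycle of `icr 1` exactly if their difference
arrays are rotations of each other (`exists_iterate_of_isRot`). So the cycles correspond to the
necklaces of sum `-1`. A rotation class contains at most one admissible array `e`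
(`Admissible.eq_of_isRot`), and it contains one unless it is the class of `0 … 0 (k-1)`, the cycle
of `0 … 0` (`exists_admissible`, `isRot_zero`). If `icr 0 s` is admissible with difference array
`e`, then `s` lies on the cycle of the array `parentArray e`, which arises from `e` by adding one
to the first entry and subtracting one from the last one; its minimal rotation is smaller
(`minRot_parentArray_lt`). This makes the cycles a tree with root `0 … 0`. The second component of
the state of `transition` is the depth in this tree modulo `k`, and it selects one of the `k`
admissible strings of a cycle, the entry string, as the place where the cycle is joined to its
parent. By induction from the leaves, the walk from an entry string traverses the whole cycle,
with a detour through each child (`reaches_icr_one`, `IsEntry.reaches`); by induction from the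
root, the walk from `0 … 0` visits every string and returns (`reaches_of_zero`). Since the depth is
a function of the string, the walk is a permutation of the `k ^ n` strings with a single cycle.

*Discrepancy.* Let the weight of a symbol in a state be its number of occurrences in the string,
plus one if it equals the depth. Writing the symbol `x` moves one unit of weight from `x - 1` to `x`
(`weight_next`), so the difference of the numbers of occurrences of `v` and `v + 1` in a factor is
the change of the weight of `v`. Telescoping gives a bound by the total weight `n + 1`. For `k = 2`
the value `n + 1` would force all the weight to be on `1` at some time, in the string `1 … 1` at
depth `1`, but that string lies on the root cycle. The lower bound comes from the factor `0 … 0`.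

*The program.* The string is shifted explicitly in each step. Admissibility is tested in linear time
by Duval's algorithm, which maintains the smallest period of the prefix read so far (`DuvalInv`),
run over two periods of the rotation in question. The program halts when the string is `0 … 0`
again. Loops without output are verified with the triples `Runs`; `Spaced` bounds the gaps between outputs.
-/

set_option linter.unusedSectionVars false

namespace DeBruijn

/-! ### Rotations and difference arrays -/

section Arrays

open scoped Fin.CommRing

variable {n k : ℕ} [NeZero n] [NeZero k]

theorem add_one_eq_zero_iff (i : Fin n) : i + 1 = 0 ↔ i = lastIdx n := by
  have hn := NeZero.pos n
  rw [Fin.ext_iff, Fin.ext_iff, Fin.val_add]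
  simp only [lastIdx, Fin.val_zero, Fin.val_one']
  rw [Nat.add_mod_mod]
  constructor
  · intro h
    by_contra hne
    rw [Nat.mod_eq_of_lt (by omega)] at h
    omega
  · intro h
    rw [h, Nat.sub_add_cancel hn, Nat.mod_self]

theorem lastIdx_add_one : lastIdx n + 1 = 0 := (add_one_eq_zero_iff _).2 rfl

theorem val_add_one_of_ne {i : Fin n} (h : i + 1 ≠ 0) : (i + 1).val = i.val + 1 := by
  have h' : i ≠ lastIdx n := fun e => h ((add_one_eq_zero_iff i).2 e)
  have h2 : i.val ≠ n - 1 := fun e => h' (Fin.ext e)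
  rw [Fin.val_add, Fin.val_one', Nat.add_mod_mod, Nat.mod_eq_of_lt (by omega)]

theorem rot_rot (d : Fin n → ZMod k) (i r : Fin n) : rot (rot d i) r = rot d (r + i) := by
  funext j; simp [rot, add_assoc]

theorem rot_zero (d : Fin n → ZMod k) : rot d 0 = d := by funext j; simp [rot]

/-- `e` is a rotation of `d`. -/
def IsRot (d e : Fin n → ZMod k) : Prop := ∃ r : Fin n, e = rot d r

theorem IsRot.refl (d : Fin n → ZMod k) : IsRot d d := ⟨0, (rot_zero d).symm⟩

theorem isRot_rot (d : Fin n → ZMod k) (r : Fin n) : IsRot d (rot d r) := ⟨r, rfl⟩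

theorem IsRot.symm {d e : Fin n → ZMod k} (h : IsRot d e) : IsRot e d := by
  obtain ⟨r, rfl⟩ := h
  exact ⟨-r, by rw [rot_rot]; simp [rot_zero]⟩

theorem IsRot.trans {d e f : Fin n → ZMod k} (h : IsRot d e) (h' : IsRot e f) : IsRot d f := by
  obtain ⟨r, rfl⟩ := h
  obtain ⟨r', rfl⟩ := h'
  exact ⟨r' + r, rot_rot _ _ _⟩

theorem icr_apply (c : ZMod k) (s : Fin n → ZMod k) (i : Fin n) :
    icr c s i = s (i + 1) + if i + 1 = 0 then c else 0 := by
  unfold icr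
  split_ifs with h
  · rw [h]
  · rw [add_zero]

theorem diffArray_apply (s : Fin n → ZMod k) (i : Fin n) :
    diffArray s i = s (i - 1) - s i - if i = 0 then 1 else 0 := by
  unfold diffArray
  split_ifs <;> simp

theorem diffArray_icr_one (s : Fin n → ZMod k) : diffArray (icr 1 s) = rot (diffArray s) 1 := by
  funext i
  simp only [rot, diffArray_apply, icr_apply, sub_add_cancel, add_sub_cancel_right]
  ring

/-- Add one to the last symbol of a string. -/
def bump (s : Fin n → ZMod k) : Fin n → ZMod k := fun i => s i + if i + 1 = 0 then 1 else 0

/-- The array obtained from `e` by adding one to its first entry and subtracting one from its last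
entry: the effect on the difference array of adding one to the last symbol of a string. -/
def parentArray (e : Fin n → ZMod k) : Fin n → ZMod k :=
  fun i => e i + (if i = 0 then 1 else 0) - if i + 1 = 0 then 1 else 0

theorem icr_add_one (c : ZMod k) (s : Fin n → ZMod k) : icr (c + 1) s = bump (icr c s) := by
  funext i
  simp only [bump, icr_apply]
  split_ifs <;> ring

theorem diffArray_bump (s : Fin n → ZMod k) : diffArray (bump s) = parentArray (diffArray s) := by
  funext i
  simp only [bump, parentArray, diffArray_apply, sub_add_cancel]
  ring

theorem iterate_icr_one (s : Fin n → ZMod k) {m : ℕ} (hm : m ≤ n) (i : Fin n) :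
    (icr 1)^[m] s i = s (i + (m : Fin n)) + if n ≤ i.val + m then 1 else 0 := by
  induction m generalizing i with
  | zero => simp
  | succ m ih =>
    rw [Function.iterate_succ_apply', icr_apply, ih (by omega)]
    have e : i + 1 + (m : Fin n) = i + ((m + 1 : ℕ) : Fin n) := by push_cast; abel
    rw [e]
    by_cases h : i + 1 = 0
    · have h2 : i.val = n - 1 := congrArg Fin.val ((add_one_eq_zero_iff i).1 h)
      have h3 : ¬ n ≤ m := by omega
      have h4 : n ≤ i.val + (m + 1) := by omega
      simp [h, h3, h4]
    · rw [val_add_one_of_ne h]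
      simp [h, add_assoc, add_comm 1 m]

theorem iterate_icr_one_length (s : Fin n → ZMod k) : (icr 1)^[n] s = fun i => s i + 1 := by
  funext i
  rw [iterate_icr_one s le_rfl]
  simp

theorem iterate_icr_one_mul (s : Fin n → ZMod k) (c : ℕ) :
    (icr 1)^[n * c] s = fun i => s i + c := by
  induction c with
  | zero => simp
  | succ c ih =>
    rw [Nat.mul_succ, Nat.add_comm, Function.iterate_add_apply, ih, iterate_icr_one_length]
    funext i
    push_cast; ring

theorem diffArray_iterate (s : Fin n → ZMod k) (m : ℕ) :
    diffArray ((icr 1)^[m] s) = rot (diffArray s) (m : Fin n) := by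
  induction m with
  | zero => simp [rot_zero]
  | succ m ih =>
    rw [Function.iterate_succ_apply', diffArray_icr_one, ih, rot_rot]
    push_cast; rw [add_comm]

/-- A string is determined by its difference array up to a constant. -/
theorem eq_add_of_diffArray_eq {s t : Fin n → ZMod k} (h : diffArray s = diffArray t) (i : Fin n) :
    t i = s i + (t 0 - s 0) := by
  have key : ∀ m : ℕ, t (m : Fin n) = s (m : Fin n) + (t 0 - s 0) := by
    intro m
    induction m with
    | zero => simp
    | succ m ih =>
      have := congrFun h ((m : Fin n) + 1)
      simp only [diffArray_apply, add_sub_cancel_right] at this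
      push_cast
      linear_combination this + ih
  simpa using key i.val

/-- Strings whose difference arrays are rotations of each other lie on one cycle of `icr 1`. -/
theorem exists_iterate_of_isRot {s t : Fin n → ZMod k} (h : IsRot (diffArray s) (diffArray t)) :
    ∃ m : ℕ, t = (icr 1)^[m] s := by
  obtain ⟨r, hr⟩ := h
  have h1 : diffArray ((icr 1)^[r.val] s) = diffArray t := by
    rw [diffArray_iterate, hr]; simp
  refine ⟨n * (t 0 - (icr 1)^[r.val] s 0).val + r.val, ?_⟩
  rw [Function.iterate_add_apply, iterate_icr_one_mul]
  funext i
  rw [eq_add_of_diffArray_eq h1 i]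
  simp

theorem isRot_icr_one (s : Fin n → ZMod k) : IsRot (diffArray s) (diffArray (icr 1 s)) :=
  ⟨1, diffArray_icr_one s⟩

theorem icr_injective (c : ZMod k) : Function.Injective (icr c : (Fin n → ZMod k) → _) := by
  intro s t h
  funext i
  have := congrFun h (i - 1)
  simp only [icr_apply, sub_add_cancel] at this
  exact add_right_cancel this

theorem exists_icr_eq (c : ZMod k) (t : Fin n → ZMod k) : ∃ s, icr c s = t :=
  (Finite.injective_iff_surjective.1 (icr_injective c)) t

theorem sum_diffArray (s : Fin n → ZMod k) : ∑ i, diffArray s i = -1 := by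
  simp only [diffArray_apply, Finset.sum_sub_distrib]
  have : ∑ i, s (i - 1) = ∑ i, s i := (Equiv.subRight (1 : Fin n)).sum_comp s
  rw [this]
  simp

/-! ### Minimal rotations -/

/-- An array as an element of the lexicographic order. -/
def lexVal (d : Fin n → ZMod k) : Lex (Fin n → ℕ) := toLex fun j => (d j).val

theorem lexLT_iff (a b : Fin n → ZMod k) : LexLT a b ↔ lexVal a < lexVal b := by
  constructor
  · rintro ⟨m, h1, h2⟩
    exact ⟨m, fun j hj => congrArg ZMod.val (h1 j hj), h2⟩
  · rintro ⟨m, h1, h2⟩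
    exact ⟨m, fun j hj => ZMod.val_injective k (h1 j hj), h2⟩

theorem lexVal_injective : Function.Injective (lexVal : (Fin n → ZMod k) → _) := by
  intro a b h
  funext j
  exact ZMod.val_injective k (congrFun (toLex_inj.1 h) j)

/-- The lexicographically minimal rotation of `d`, as an element of the lexicographic order. -/
noncomputable def minRot (d : Fin n → ZMod k) : Lex (Fin n → ℕ) :=
  Finset.univ.inf' Finset.univ_nonempty fun r : Fin n => lexVal (rot d r)

theorem minRot_le {d e : Fin n → ZMod k} (h : IsRot d e) : minRot d ≤ lexVal e := by
  obtain ⟨r, rfl⟩ := h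
  exact Finset.inf'_le _ (Finset.mem_univ r)

theorem exists_minRot (d : Fin n → ZMod k) : ∃ r, minRot d = lexVal (rot d r) := by
  obtain ⟨r, -, h⟩ := Finset.exists_mem_eq_inf' (Finset.univ_nonempty (α := Fin n))
    fun r : Fin n => lexVal (rot d r)
  exact ⟨r, h⟩

theorem minRot_le_of_isRot {d e : Fin n → ZMod k} (h : IsRot d e) : minRot d ≤ minRot e := by
  obtain ⟨r, hr⟩ := exists_minRot e
  rw [hr]
  exact minRot_le (h.trans (isRot_rot e r))

theorem minRot_eq {d e : Fin n → ZMod k} (h : IsRot d e) : minRot d = minRot e :=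
  le_antisymm (minRot_le_of_isRot h) (minRot_le_of_isRot h.symm)

/-! ### Admissible arrays -/

/-- The run of zeros of `d` just before its last entry starts at position `i`, and the rotation of
`d` starting there is minimal. -/
def AdmissibleAt (d : Fin n → ZMod k) (i : Fin n) : Prop :=
  i ≠ 0 ∧ d (i - 1) ≠ 0 ∧ (∀ j : Fin n, i ≤ j → j < lastIdx n → d j = 0) ∧
    ∀ r : Fin n, ¬ LexLT (rot d r) (rot d i)

/-- The condition on `d = Δ(s)` in the definition of an admissible string `s`. -/
def Admissible (d : Fin n → ZMod k) : Prop :=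
  d (lastIdx n) ≠ 0 ∧ ∃ i : Fin n, AdmissibleAt d i

theorem correctDiffArray_iff (s : Fin n → ZMod k) :
    CorrectDiffArray s ↔ Admissible (diffArray s) := Iff.rfl

theorem AdmissibleAt.minRot_eq {d : Fin n → ZMod k} {i : Fin n} (h : AdmissibleAt d i) :
    minRot d = lexVal (rot d i) := by
  obtain ⟨r, hr⟩ := exists_minRot d
  refine le_antisymm (minRot_le (isRot_rot d i)) ?_
  rw [hr]
  exact not_lt.1 fun hlt => h.2.2.2 r ((lexLT_iff _ _).2 hlt)

theorem le_lastIdx (i : Fin n) : i ≤ lastIdx n := by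
  have := i.isLt
  rw [Fin.le_def]; simp only [lastIdx]; omega

theorem val_add_of_lt {i j : Fin n} (h : i.val + j.val < n) : (i + j).val = i.val + j.val := by
  rw [Fin.val_add, Nat.mod_eq_of_lt h]

/-- The parent array has a smaller minimal rotation: the first nonzero entry of the minimal
rotation is the last entry of `e`, which drops by one. -/
theorem minRot_parentArray_lt {e : Fin n → ZMod k} (h : Admissible e) :
    minRot (parentArray e) < minRot e := by
  obtain ⟨hl, i, hi⟩ := h
  rw [hi.minRot_eq]
  refine lt_of_le_of_lt (minRot_le (isRot_rot _ i)) ?_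
  refine (lexLT_iff _ _).1 ?_
  have hi0 : i.val ≠ 0 := fun h0 => hi.1 (Fin.ext h0)
  have hlast : (lastIdx n - i) + i = lastIdx n := sub_add_cancel _ _
  have hv : (lastIdx n - i).val = n - 1 - i.val := by
    rw [Fin.sub_val_of_le (le_lastIdx i)]; rfl
  refine ⟨lastIdx n - i, fun j hj => ?_, ?_⟩
  · have hj' : j.val + i.val < n - 1 := by
      rw [Fin.lt_def, hv] at hj; omega
    have hval := val_add_of_lt (i := j) (j := i) (by omega)
    have h1 : j + i ≠ 0 := fun h0 => by
      rw [h0, Fin.val_zero] at hval; omega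
    have h2 : ¬ (j + i + 1 = 0) := fun h0 => by
      have := congrArg Fin.val ((add_one_eq_zero_iff _).1 h0)
      rw [hval] at this; simp only [lastIdx] at this; omega
    simp [rot, parentArray, h1, h2]
  · simp only [rot, hlast, parentArray, lastIdx_add_one, if_true]
    have h1 : lastIdx n ≠ 0 := fun h0 => by
      have := congrArg Fin.val h0
      have hlt := i.isLt
      simp only [lastIdx, Fin.val_zero] at this; omega
    rw [if_neg h1, add_zero]
    have hpos : 0 < (e (lastIdx n)).val := Nat.pos_of_ne_zero fun h0 => hl ((ZMod.val_eq_zero _).1 h0)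
    rcases Nat.lt_or_ge 1 k with hk | hk
    · have : Fact (1 < k) := ⟨hk⟩
      rw [ZMod.val_sub (by rw [ZMod.val_one]; omega), ZMod.val_one]
      omega
    · have := ZMod.val_lt (e (lastIdx n)); omega

/-- An array has at most one admissible rotation. -/
theorem Admissible.eq_of_isRot {d e : Fin n → ZMod k} (hd : Admissible d) (he : Admissible e)
    (h : IsRot d e) : d = e := by
  obtain ⟨hdl, i, hi⟩ := hd
  obtain ⟨hel, i', hi'⟩ := he
  have heq : rot d i = rot e i' := lexVal_injective (by
    rw [← hi.minRot_eq, ← hi'.minRot_eq, minRot_eq h])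
  have aux : ∀ {a b : Fin n → ZMod k} {x y : Fin n}, a (lastIdx n) ≠ 0 → AdmissibleAt b y →
      rot a x = rot b y → x ≤ y := by
    intro a b x y ha hb hab
    by_contra hxy
    have hxy' : y.val < x.val := Fin.lt_def.1 (not_le.1 hxy)
    have hlt := x.isLt
    have h1 := congrFun hab (lastIdx n - x)
    simp only [rot, sub_add_cancel] at h1
    have hv : (lastIdx n - x).val = n - 1 - x.val := by
      rw [Fin.sub_val_of_le (le_lastIdx x)]; rfl
    have hv2 := val_add_of_lt (i := lastIdx n - x) (j := y) (by omega)
    refine ha (h1.trans (hb.2.2.1 _ ?_ ?_))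
    · rw [Fin.le_def]; omega
    · rw [Fin.lt_def, hv2, hv]; simp only [lastIdx]; omega
  have hii : i = i' := le_antisymm (aux hdl hi' heq) (aux hel hi heq.symm)
  subst hii
  have := congrArg (fun f => rot f (-i)) heq
  simpa [rot_rot, rot_zero] using this

/-- An array with two nonzero entries has an admissible rotation. -/
theorem exists_admissible {d : Fin n → ZMod k} {x y : Fin n} (hxy : x ≠ y) (hx : d x ≠ 0)
    (hy : d y ≠ 0) : ∃ e, IsRot d e ∧ Admissible e := by
  obtain ⟨r, hr⟩ := exists_minRot d
  obtain ⟨b, hb⟩ : ∃ b, b = rot d r := ⟨_, rfl⟩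
  have hrot : IsRot d b := ⟨r, hb⟩
  rw [← hb] at hr
  -- the first nonzero entry of the minimal rotation
  have hex : ∃ m : ℕ, ∃ hm : m < n, b ⟨m, hm⟩ ≠ 0 :=
    ⟨(x - r).val, (x - r).isLt, by simpa [hb, rot] using hx⟩
  classical
  obtain ⟨m, ⟨hm, hbm⟩, hmin⟩ : ∃ m : ℕ, (∃ hm : m < n, b ⟨m, hm⟩ ≠ 0) ∧
      ∀ j : Fin n, j.val < m → b j = 0 :=
    ⟨Nat.find hex, Nat.find_spec hex, fun j hj => by
      have := Nat.find_min hex hj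
      by_contra h
      exact this ⟨j.isLt, h⟩⟩
  have hm' : m < n - 1 := by
    by_contra hge
    have aux : ∀ z, d z ≠ 0 → z - r = lastIdx n := fun z hz => by
      by_contra hne
      have hbz : b (z - r) ≠ 0 := by simpa [hb, rot] using hz
      refine hbz (hmin _ ?_)
      have h1 := (z - r).isLt
      have h2 : (z - r).val ≠ n - 1 := fun h => hne (Fin.ext h)
      omega
    exact hxy (sub_left_injective ((aux x hx).trans (aux y hy).symm))
  have hbl : b (lastIdx n) ≠ 0 := by
    intro h0
    have hlt : LexLT (rot b (-1)) b := by
      refine ⟨⟨m, hm⟩, fun j hj => ?_, ?_⟩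
      · rw [hmin j (Fin.lt_def.1 hj)]
        by_cases hj0 : j = 0
        · have : j + -1 = lastIdx n := by
            rw [← add_one_eq_zero_iff]; simp [hj0]
          simp only [rot, this, h0]
        · refine hmin _ ?_
          rw [← sub_eq_add_neg, Fin.val_sub_one_of_ne_zero hj0]
          have := Fin.lt_def.1 hj
          simp only at this; omega
      · have hz : rot b (-1) ⟨m, hm⟩ = 0 := by
          by_cases hj0 : (⟨m, hm⟩ : Fin n) = 0
          · have : (⟨m, hm⟩ : Fin n) + -1 = lastIdx n := by
              rw [← add_one_eq_zero_iff]; simp [hj0]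
            simp only [rot, this, h0]
          · refine hmin _ ?_
            rw [← sub_eq_add_neg, Fin.val_sub_one_of_ne_zero hj0]
            have h1 : m ≠ 0 := fun h => hj0 (Fin.ext h)
            simp only; omega
        rw [hz, ZMod.val_zero]
        exact Nat.pos_of_ne_zero fun h0 => hbm ((ZMod.val_eq_zero _).1 h0)
    rw [lexLT_iff, ← hr] at hlt
    exact not_lt.2 (minRot_le (hrot.trans (isRot_rot b (-1)))) hlt
  -- rotate so that this entry comes last
  have hi : n - 1 - m < n := by omega
  let i : Fin n := ⟨n - 1 - m, hi⟩
  have hri : ∀ j, rot b (-i) j = b (j - i) := fun j => by simp [rot, sub_eq_add_neg]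
  refine ⟨rot b (-i), hrot.trans (isRot_rot _ _), ?_, i, ?_, ?_, ?_, ?_⟩
  · rw [hri]
    have : lastIdx n - i = ⟨m, hm⟩ := Fin.ext (by
      rw [Fin.sub_val_of_le (le_lastIdx i)]; simp only [lastIdx, i]; omega)
    rwa [this]
  · intro h; have := congrArg Fin.val h; simp only [i, Fin.val_zero] at this; omega
  · rw [hri]
    have : i - 1 - i = lastIdx n := by
      rw [← add_one_eq_zero_iff]; abel
    rwa [this]
  · intro j hj1 hj2
    rw [hri]
    refine hmin _ ?_
    rw [Fin.sub_val_of_le hj1]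
    rw [Fin.lt_def] at hj2
    rw [Fin.le_def] at hj1
    simp only [lastIdx, i] at *; omega
  · intro t hlt
    rw [rot_rot, rot_rot, add_neg_cancel, rot_zero, lexLT_iff, ← hr] at hlt
    exact not_lt.2 (minRot_le (hrot.trans (isRot_rot b _))) hlt

end Arrays

section Tree

open scoped Fin.CommRing

variable {n k : ℕ} [NeZero n] [NeZero k]

/-! ### The tree of cycles -/

open Classical in
/-- The depth modulo `k` of a rotation class of arrays in the tree whose root is the class of
`0 … 0 (k-1)` and in which the parent of the class of an admissible array `e` is the class of
`parentArray e`. -/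
noncomputable def depth (d : Fin n → ZMod k) : ZMod k :=
  if h : ∃ e, IsRot d e ∧ Admissible e then depth (parentArray h.choose) + 1 else 0
termination_by (wellFounded_lt (α := Lex (Fin n → ℕ))).wrap (minRot d)
decreasing_by
  change minRot _ < minRot d
  rw [minRot_eq h.choose_spec.1]
  exact minRot_parentArray_lt h.choose_spec.2

theorem depth_eq_of_admissible {d e : Fin n → ZMod k} (h : IsRot d e) (he : Admissible e) :
    depth d = depth (parentArray e) + 1 := by
  have hex : ∃ e, IsRot d e ∧ Admissible e := ⟨e, h, he⟩
  rw [depth, dif_pos hex]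
  rw [hex.choose_spec.2.eq_of_isRot he (hex.choose_spec.1.symm.trans h)]

theorem depth_eq_zero {d : Fin n → ZMod k} (h : ¬ ∃ e, IsRot d e ∧ Admissible e) :
    depth d = 0 := by
  rw [depth, dif_neg h]

theorem depth_eq_of_isRot {d e : Fin n → ZMod k} (h : IsRot d e) : depth d = depth e := by
  by_cases hex : ∃ f, IsRot d f ∧ Admissible f
  · obtain ⟨f, hf, hf'⟩ := hex
    rw [depth_eq_of_admissible hf hf', depth_eq_of_admissible (h.symm.trans hf) hf']
  · rw [depth_eq_zero hex, depth_eq_zero]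
    rintro ⟨f, hf, hf'⟩
    exact hex ⟨f, h.trans hf, hf'⟩

theorem depth_icr_one (s : Fin n → ZMod k) :
    depth (diffArray (icr 1 s)) = depth (diffArray s) :=
  (depth_eq_of_isRot (isRot_icr_one s)).symm

/-- The step from the parent into a child: `icr 0 s` lies one level below `s`. -/
theorem depth_icr_zero {s : Fin n → ZMod k} (h : CorrectDiffArray (icr 0 s)) :
    depth (diffArray (icr 0 s)) = depth (diffArray s) + 1 := by
  rw [depth_eq_of_admissible (IsRot.refl _) h, ← diffArray_bump, ← icr_add_one, zero_add,
    depth_icr_one]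

/-- The step from a child back to its parent: `icr 2 s` lies one level above `s`. -/
theorem depth_icr_two {s : Fin n → ZMod k} (h : CorrectDiffArray (icr 1 s)) :
    depth (diffArray (icr 2 s)) = depth (diffArray s) - 1 := by
  rw [← depth_icr_one s, depth_eq_of_admissible (IsRot.refl _) h, ← diffArray_bump,
    ← icr_add_one, one_add_one_eq_two, add_sub_cancel_right]

theorem minRot_lt_of_icr_zero {s : Fin n → ZMod k} (h : CorrectDiffArray (icr 0 s)) :
    minRot (diffArray s) < minRot (diffArray (icr 0 s)) := by
  have := minRot_parentArray_lt h
  rwa [← diffArray_bump, ← icr_add_one, zero_add, ← minRot_eq (isRot_icr_one s)] at this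

/-- A string together with the depth of its cycle. -/
noncomputable def withDepth (s : Fin n → ZMod k) : (Fin n → ZMod k) × ZMod k :=
  (s, depth (diffArray s))

/-- The successor of `s` under `transition` at the right depth. -/
noncomputable def next (s : Fin n → ZMod k) : Fin n → ZMod k := (transition (withDepth s)).1

theorem transition_withDepth (s : Fin n → ZMod k) :
    transition (withDepth s) = withDepth (next s) := by
  unfold next
  unfold transition withDepth
  simp only
  split_ifs with h1 h2
  · rw [depth_icr_zero h1.1]
  · rw [depth_icr_two h2.1]
  · rw [depth_icr_one]

theorem next_eq_icr_zero {s : Fin n → ZMod k} (h : CorrectDiffArray (icr 0 s))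
    (h' : icr 0 s (lastIdx n) = depth (diffArray s) + 1) : next s = icr 0 s := by
  unfold next transition withDepth
  rw [if_pos ⟨h, h'⟩]

theorem bump_lastIdx (s : Fin n → ZMod k) : bump s (lastIdx n) = s (lastIdx n) + 1 := by
  simp [bump, lastIdx_add_one]

theorem next_eq_icr_two (hk : 2 ≤ k) {s : Fin n → ZMod k} (h : CorrectDiffArray (icr 1 s))
    (h' : icr 1 s (lastIdx n) = depth (diffArray s)) : next s = icr 2 s := by
  unfold next transition withDepth
  simp only
  have hb : icr 1 s = bump (icr 0 s) := by rw [← icr_add_one, zero_add]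
  rw [if_neg, if_pos ⟨h, h'⟩]
  -- both rules could only apply if `1 = -1`, and then the last entries of the two difference
  -- arrays would be distinct and nonzero
  rintro ⟨h0, h0'⟩
  rw [hb, bump_lastIdx, h0'] at h'
  have h2 : (2 : ZMod k) = 0 := by linear_combination h'
  have hk2 : k = 2 := by
    have := (ZMod.natCast_eq_zero_iff 2 k).1 (by exact_mod_cast h2)
    have := Nat.le_of_dvd (by norm_num) this
    omega
  have e := h.1
  have e0 := h0.1
  rw [hb, diffArray_bump] at e
  have hn : lastIdx n ≠ 0 := by
    obtain ⟨i, hi, -⟩ := h.2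
    intro h0
    exact hi (nonpos_iff_eq_zero.1 (h0 ▸ le_lastIdx i))
  simp only [parentArray, lastIdx_add_one, if_true, if_neg hn, add_zero] at e
  subst hk2
  generalize diffArray (icr 0 s) (lastIdx n) = z at *
  revert e e0
  revert z
  decide

theorem next_eq_icr_one {s : Fin n → ZMod k}
    (h1 : ¬ (CorrectDiffArray (icr 0 s) ∧ icr 0 s (lastIdx n) = depth (diffArray s) + 1))
    (h2 : ¬ (CorrectDiffArray (icr 1 s) ∧ icr 1 s (lastIdx n) = depth (diffArray s))) :
    next s = icr 1 s := by
  unfold next transition withDepth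
  rw [if_neg h1, if_neg h2]

/-! ### Every string is reached -/

/-- Iterating `next` leads from `s` to `t` in at least one step. -/
def Reaches : (Fin n → ZMod k) → (Fin n → ZMod k) → Prop :=
  Relation.TransGen fun s t => t = next s

theorem reaches_next (s : Fin n → ZMod k) : Reaches s (next s) := Relation.TransGen.single rfl

/-- The string `t` is where the construction enters the cycle of `t` from its parent. -/
def IsEntry (t : Fin n → ZMod k) : Prop :=
  CorrectDiffArray t ∧ t (lastIdx n) = depth (diffArray t)

theorem minRot_wellFounded :
    WellFounded fun d e : Fin n → ZMod k => minRot e < minRot d := by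
  have : IsTrans (Fin n → ZMod k) fun d e => minRot e < minRot d :=
    ⟨fun a b c h1 h2 => lt_trans h2 h1⟩
  have : Std.Irrefl (α := Fin n → ZMod k) fun d e => minRot e < minRot d := ⟨fun a => lt_irrefl _⟩
  exact Finite.wellFounded_of_trans_of_irrefl _

theorem IsEntry.eq_of_isRot {s t : Fin n → ZMod k} (hs : IsEntry s) (ht : IsEntry t)
    (h : IsRot (diffArray s) (diffArray t)) : s = t := by
  have h1 := eq_add_of_diffArray_eq (Admissible.eq_of_isRot hs.1 ht.1 h)
  have h2 := h1 (lastIdx n)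
  rw [hs.2, ht.2, depth_eq_of_isRot h] at h2
  have h3 : t 0 - s 0 = 0 := by linear_combination -h2
  funext i
  rw [h1, h3, add_zero]

/-- If every entry string of a child of the cycle of `z` traverses its cycle, then `z` reaches its
successor on its own cycle, unless that successor is an entry string: either directly, or by
way of a child and its descendants. -/
theorem reaches_icr_one (hk : 2 ≤ k) {z : Fin n → ZMod k}
    (ih : ∀ t : Fin n → ZMod k, IsEntry t → minRot (diffArray z) < minRot (diffArray t) →
      ∀ m, t = (icr 1)^[m] t ∨ Reaches t ((icr 1)^[m] t))
    (hz : ¬ IsEntry (icr 1 z)) : Reaches z (icr 1 z) := by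
  have hz' : ¬ (CorrectDiffArray (icr 1 z) ∧ icr 1 z (lastIdx n) = depth (diffArray z)) := by
    rw [← depth_icr_one]; exact hz
  by_cases h1 : CorrectDiffArray (icr 0 z) ∧ icr 0 z (lastIdx n) = depth (diffArray z) + 1
  · obtain ⟨h1, h1'⟩ := h1
    have hent : IsEntry (icr 0 z) := ⟨h1, by rw [h1', depth_icr_zero h1]⟩
    have hstep : Reaches z (icr 0 z) := by
      have := reaches_next z
      rwa [next_eq_icr_zero h1 h1'] at this
    -- the last string `f` of the detour
    obtain ⟨f, hf⟩ := exists_icr_eq 1 (icr 0 z)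
    obtain ⟨m, hm⟩ := exists_iterate_of_isRot (s := icr 0 z) (t := f)
      (by rw [← hf]; exact (isRot_icr_one f).symm)
    have hzf : Reaches z f := by
      rcases ih _ hent (minRot_lt_of_icr_zero h1) m with h | h
      · rw [hm, ← h]; exact hstep
      · rw [hm]; exact hstep.trans h
    have hfn : next f = icr 1 z := by
      rw [next_eq_icr_two hk (by rw [hf]; exact h1) (by rw [← depth_icr_one, hf]; exact hent.2),
        ← one_add_one_eq_two, icr_add_one, hf, ← icr_add_one, zero_add]
    exact hfn ▸ hzf.trans (reaches_next f)
  · have := reaches_next z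
    rwa [next_eq_icr_one h1 hz'] at this

/-- The construction traverses the whole cycle of an entry string. -/
theorem IsEntry.reaches (hk : 2 ≤ k) {t : Fin n → ZMod k} (ht : IsEntry t) (m : ℕ) :
    t = (icr 1)^[m] t ∨ Reaches t ((icr 1)^[m] t) := by
  have main : ∀ d : Fin n → ZMod k, ∀ t, diffArray t = d → IsEntry t → ∀ m,
      t = (icr 1)^[m] t ∨ Reaches t ((icr 1)^[m] t) := by
    intro d
    induction d using (minRot_wellFounded (n := n) (k := k)).induction with
    | _ d ih =>
    intro t hd ht m
    induction m with
    | zero => exact Or.inl rfl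
    | succ m ihm =>
      rw [Function.iterate_succ_apply']
      have hrot : IsRot (diffArray t) (diffArray ((icr 1)^[m] t)) :=
        ⟨_, diffArray_iterate t m⟩
      by_cases hz : IsEntry (icr 1 ((icr 1)^[m] t))
      · exact Or.inl (ht.eq_of_isRot hz (hrot.trans (isRot_icr_one _)))
      · have h1 : Reaches ((icr 1)^[m] t) (icr 1 ((icr 1)^[m] t)) := by
          refine reaches_icr_one hk (fun t' ht' hlt m' => ih _ ?_ t' rfl ht' m') hz
          rwa [← hd, minRot_eq hrot]
        rcases ihm with h | h
        · rw [← h] at h1 ⊢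
          exact Or.inr h1
        · exact Or.inr (h.trans h1)
  exact main _ t rfl ht m

/-- Every cycle other than the root has an entry string. -/
theorem exists_isEntry {s : Fin n → ZMod k} (h : ∃ e, IsRot (diffArray s) e ∧ Admissible e) :
    ∃ t, IsEntry t ∧ IsRot (diffArray s) (diffArray t) := by
  obtain ⟨e, ⟨r, hr⟩, he⟩ := h
  obtain ⟨t, ht⟩ : ∃ t, t = (icr 1)^[r.val] s := ⟨_, rfl⟩
  have hd : diffArray t = e := by rw [ht, diffArray_iterate, hr]; simp
  obtain ⟨c, hc⟩ : ∃ c, c = (depth e - t (lastIdx n)).val := ⟨_, rfl⟩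
  have hu : diffArray ((icr 1)^[n * c] t) = e := by
    rw [iterate_icr_one_mul, ← hd]
    funext i
    simp only [diffArray_apply]
    ring
  refine ⟨(icr 1)^[n * c] t, ⟨?_, ?_⟩, ?_⟩
  · rw [correctDiffArray_iff, hu]; exact he
  · rw [hu, iterate_icr_one_mul, hc]
    simp
  · rw [hu]; exact ⟨r, hr⟩

/-- The cycle without an entry string is the cycle of `0 … 0`. -/
theorem isRot_zero (hk : 2 ≤ k) {s : Fin n → ZMod k}
    (h : ¬ ∃ e, IsRot (diffArray s) e ∧ Admissible e) :
    IsRot (diffArray fun _ : Fin n => (0 : ZMod k)) (diffArray s) := by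
  have : Fact (1 < k) := ⟨hk⟩
  obtain ⟨x, hx⟩ : ∃ x, diffArray s x ≠ 0 := by
    by_contra! hall
    have := sum_diffArray s
    simp [hall] at this
  have hy : ∀ y, y ≠ x → diffArray s y = 0 := by
    intro y hyx
    by_contra hy
    exact h (exists_admissible hyx hy hx)
  have hx1 : diffArray s x = -1 := by
    rw [← sum_diffArray s, Finset.sum_eq_single x (fun y _ hyx => hy y hyx) (by simp)]
  refine ⟨-x, ?_⟩
  funext j
  simp only [rot, diffArray_apply (fun _ : Fin n => (0 : ZMod k))]
  by_cases hj : j = x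
  · simp [hj, hx1]
  · rw [hy j hj]
    have : ¬ (j + -x = 0) := fun h => hj (by rwa [← sub_eq_add_neg, sub_eq_zero] at h)
    simp [this]

theorem not_admissible_of_isRot_zero {e : Fin n → ZMod k}
    (h : IsRot (diffArray fun _ : Fin n => (0 : ZMod k)) e) : ¬ Admissible e := by
  rintro ⟨h1, i, h2, h3, -⟩
  obtain ⟨r, hr⟩ := h
  have aux : ∀ j, e j ≠ 0 → j + r = 0 := by
    intro j hj
    by_contra hne
    exact hj (by rw [hr]; simp [rot, diffArray_apply, hne])
  have e := add_right_cancel ((aux _ h1).trans (aux _ h3).symm)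
  apply h2
  have := lastIdx_add_one (n := n)
  rw [e] at this
  simpa using this

theorem depth_zero : depth (diffArray fun _ : Fin n => (0 : ZMod k)) = 0 :=
  depth_eq_zero fun ⟨_, h, h'⟩ => not_admissible_of_isRot_zero h h'

theorem reaches_of_isRot_zero (hk : 2 ≤ k) {s : Fin n → ZMod k}
    (h : IsRot (diffArray fun _ : Fin n => (0 : ZMod k)) (diffArray s)) :
    Reaches s (icr 1 s) :=
  reaches_icr_one hk (fun _ ht _ m => ht.reaches hk m)
    fun h' => not_admissible_of_isRot_zero (h.trans (isRot_icr_one s)) h'.1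

/-- Starting from `0 … 0` the construction visits every string, and comes back to `0 … 0`. -/
theorem reaches_of_zero (hk : 2 ≤ k) (s : Fin n → ZMod k) :
    Reaches (fun _ : Fin n => (0 : ZMod k)) s := by
  have root : ∀ m, Reaches (fun _ : Fin n => (0 : ZMod k))
      ((icr 1)^[m + 1] (fun _ : Fin n => (0 : ZMod k))) := by
    intro m
    have hrot : ∀ m, IsRot (diffArray fun _ : Fin n => (0 : ZMod k))
        (diffArray ((icr 1)^[m] (fun _ : Fin n => (0 : ZMod k)))) :=
      fun m => ⟨_, diffArray_iterate _ m⟩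
    induction m with
    | zero => exact reaches_of_isRot_zero hk (hrot 0)
    | succ m ihm =>
      rw [Function.iterate_succ_apply']
      exact ihm.trans (reaches_of_isRot_zero hk (hrot _))
  have main : ∀ x : Lex (Fin n → ℕ), ∀ s : Fin n → ZMod k, minRot (diffArray s) = x →
      Reaches (fun _ : Fin n => (0 : ZMod k)) s := by
    intro x
    induction x using WellFoundedLT.induction with
    | _ x ih =>
    intro s hx
    by_cases hex : ∃ e, IsRot (diffArray s) e ∧ Admissible e
    · obtain ⟨t, ht, hst⟩ := exists_isEntry hex
      obtain ⟨z, rfl⟩ := exists_icr_eq 0 t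
      have h1 := ih (minRot (diffArray z))
        (by rw [← hx, minRot_eq hst]; exact minRot_lt_of_icr_zero ht.1) z rfl
      have h2 : next z = icr 0 z := next_eq_icr_zero ht.1 (by rw [← depth_icr_zero ht.1]; exact ht.2)
      have h3 := h1.trans (reaches_next z)
      rw [h2] at h3
      obtain ⟨m, rfl⟩ := exists_iterate_of_isRot hst.symm
      rcases ht.reaches hk m with h | h
      · rwa [← h]
      · exact h3.trans h
    · obtain ⟨m, rfl⟩ := exists_iterate_of_isRot (isRot_zero hk hex)
      -- go around the cycle at least once
      have h := root (n * k + m - 1)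
      have hpos : 0 < n * k := Nat.mul_pos (NeZero.pos n) (NeZero.pos k)
      rw [show n * k + m - 1 + 1 = m + n * k by omega, Function.iterate_add_apply,
        iterate_icr_one_mul] at h
      simpa using h
  exact main _ s rfl

theorem exists_iterate_of_reaches {s t : Fin n → ZMod k} (h : Reaches s t) :
    ∃ m, next^[m + 1] s = t := by
  induction h with
  | single h => exact ⟨0, h.symm⟩
  | tail _ h ih =>
    obtain ⟨m, hm⟩ := ih
    exact ⟨m + 1, by rw [Function.iterate_succ_apply', hm, h]⟩

theorem next_bijective (hk : 2 ≤ k) :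
    Function.Bijective (next : (Fin n → ZMod k) → (Fin n → ZMod k)) := by
  refine Finite.injective_iff_bijective.1 (Finite.injective_iff_surjective.2 fun t => ?_)
  obtain ⟨m, hm⟩ := exists_iterate_of_reaches (reaches_of_zero hk t)
  exact ⟨next^[m] (fun _ => 0), by rw [← Function.iterate_succ_apply' next, hm]⟩

theorem card_strings : Fintype.card (Fin n → ZMod k) = k ^ n := by
  simp [ZMod.card]

/-- The string `0 … 0` returns for the first time after `k ^ n` steps. -/
theorem minimalPeriod_next (hk : 2 ≤ k) :
    Function.minimalPeriod next (fun _ : Fin n => (0 : ZMod k)) = k ^ n := by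
  obtain ⟨x0, hx0⟩ : ∃ x0, x0 = fun _ : Fin n => (0 : ZMod k) := ⟨_, rfl⟩
  rw [← hx0]
  have hper : x0 ∈ Function.periodicPts (next : (Fin n → ZMod k) → _) := by
    obtain ⟨m, hm⟩ := exists_iterate_of_reaches (reaches_of_zero hk x0)
    rw [← hx0] at hm
    exact ⟨m + 1, Nat.succ_pos m, hm⟩
  have hpos := Function.minimalPeriod_pos_of_mem_periodicPts hper
  rw [← card_strings (n := n) (k := k), ← Fintype.card_fin (Function.minimalPeriod next x0)]
  refine Fintype.card_of_bijective (f := fun j : Fin _ => next^[j.val] x0) ⟨?_, ?_⟩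
  · intro i j hij
    exact Fin.ext (Function.iterate_injOn_Iio_minimalPeriod i.isLt j.isLt hij)
  · intro t
    obtain ⟨m, hm⟩ := exists_iterate_of_reaches (reaches_of_zero hk t)
    refine ⟨⟨(m + 1) % Function.minimalPeriod next x0, Nat.mod_lt _ hpos⟩, ?_⟩
    simp only [Function.iterate_mod_minimalPeriod_eq]
    rw [hx0, hm]

end Tree

section Word

open scoped Fin.CommRing

variable {n k : ℕ} [NeZero n] [NeZero k]

/-! ### The de Bruijn property -/

/-- The string visited after `t` steps. -/
noncomputable def visited (n k : ℕ) [NeZero n] [NeZero k] (t : ℕ) : Fin n → ZMod k :=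
  next^[t] fun _ => 0

theorem visited_succ (t : ℕ) : visited n k (t + 1) = next (visited n k t) :=
  Function.iterate_succ_apply' _ _ _

theorem transition_iterate (t : ℕ) :
    transition^[t] (fun _ : Fin n => (0 : ZMod k), (0 : ZMod k)) = withDepth (visited n k t) := by
  induction t with
  | zero => simp [visited, withDepth, depth_zero]
  | succ t ih => rw [Function.iterate_succ_apply', ih, transition_withDepth, visited_succ]

theorem icrWord_apply (j : Fin (k ^ n)) :
    icrWord n k j = visited n k (j.val + 1) (lastIdx n) := by
  unfold icrWord
  rw [transition_iterate]
  rfl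

theorem next_apply_of_ne (s : Fin n → ZMod k) {i : Fin n} (hi : i + 1 ≠ 0) :
    next s i = s (i + 1) := by
  unfold next transition withDepth
  simp only
  split_ifs <;> simp [icr_apply, hi]

theorem visited_apply (t m : ℕ) (i : Fin n) (hi : i.val + m + 1 = n) :
    visited n k (t + m) i = visited n k t (lastIdx n) := by
  induction m generalizing i with
  | zero =>
    have : i = lastIdx n := Fin.ext (by simp only [lastIdx]; omega)
    rw [this, add_zero]
  | succ m ih =>
    have hne : i + 1 ≠ 0 := fun h => by
      have := congrArg Fin.val ((add_one_eq_zero_iff i).1 h)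
      simp only [lastIdx] at this; omega
    rw [← add_assoc, visited_succ, next_apply_of_ne _ hne]
    exact ih _ (by rw [val_add_one_of_ne hne]; omega)

theorem visited_periodic (hk : 2 ≤ k) : Function.Periodic (visited n k) (k ^ n) := by
  intro t
  unfold visited
  rw [Function.iterate_add_apply, ← minimalPeriod_next hk, Function.iterate_minimalPeriod]

theorem visited_mod (hk : 2 ≤ k) (t u : ℕ) :
    visited n k (t % k ^ n + u) = visited n k (t + u) := by
  conv_rhs => rw [← Nat.mod_add_div t (k ^ n)]
  rw [add_right_comm, mul_comm]
  exact ((visited_periodic hk).nat_mul _ _).symm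

theorem visited_bijective (hk : 2 ≤ k) (u : ℕ) :
    Function.Bijective fun i : Fin (k ^ n) => visited n k (i.val + u) := by
  rw [Fintype.bijective_iff_injective_and_card]
  refine ⟨fun i j hij => ?_, by rw [card_strings, Fintype.card_fin]⟩
  simp only [visited] at hij
  rw [add_comm, Function.iterate_add_apply, add_comm, Function.iterate_add_apply] at hij
  have h := (next_bijective hk).1.iterate u hij
  refine Fin.ext (Function.iterate_injOn_Iio_minimalPeriod ?_ ?_ h)
  · rw [minimalPeriod_next hk]; exact i.isLt
  · rw [minimalPeriod_next hk]; exact j.isLt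

theorem factor_icrWord (hk : 2 ≤ k) (i : Fin (k ^ n)) (l : ℕ) :
    factor (icrWord n k) i l =
      List.ofFn fun j : Fin l => visited n k (i.val + j.val + 1) (lastIdx n) := by
  unfold factor
  congr 1
  funext j
  rw [icrWord_apply, visited_mod hk]

theorem isDeBruijn_icrWord (hk : 2 ≤ k) : IsDeBruijn n (icrWord n k) := by
  refine ⟨by rw [ZMod.card], fun u hu => ?_⟩
  have hfac : ∀ i : Fin (k ^ n), factor (icrWord n k) i n = List.ofFn (visited n k (i.val + n)) := by
    intro i
    rw [factor_icrWord hk]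
    congr 1
    funext j
    rw [← visited_apply (i.val + j.val + 1) (n - 1 - j.val) j
      (by have := j.isLt; omega)]
    have hj : i.val + n = i.val + j.val + 1 + (n - 1 - j.val) := by have := j.isLt; omega
    rw [hj]
  obtain ⟨v, rfl⟩ : ∃ v : Fin n → ZMod k, List.ofFn v = u := by
    subst hu
    exact ⟨u.get, List.ofFn_get u⟩
  obtain ⟨i, hi, huniq⟩ := (visited_bijective hk n).existsUnique v
  exact ⟨i, (hfac i).trans (congrArg List.ofFn hi), fun j hj =>
    huniq j (List.ofFn_injective ((hfac j).symm.trans hj))⟩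

/-! ### Discrepancy -/

/-- The number of occurrences of `v` in `s`, where the depth counts as an additional symbol. -/
noncomputable def weight (s : Fin n → ZMod k) (v : ZMod k) : ℤ :=
  (∑ i, if s i = v then 1 else 0) + if depth (diffArray s) = v then 1 else 0

theorem weight_nonneg (s : Fin n → ZMod k) (v : ZMod k) : 0 ≤ weight s v := by
  unfold weight
  have : (0 : ℤ) ≤ ∑ i, if s i = v then 1 else 0 :=
    Finset.sum_nonneg fun i _ => by split_ifs <;> norm_num
  split_ifs <;> omega

theorem sum_weight (s : Fin n → ZMod k) : ∑ v, weight s v = n + 1 := by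
  simp only [weight, Finset.sum_add_distrib]
  rw [Finset.sum_comm]
  simp

theorem sum_next (s : Fin n → ZMod k) (f : ZMod k → ℤ) :
    ∑ i, f (next s i) = ∑ i, f (s i) - f (s 0) + f (next s (lastIdx n)) := by
  have h1 : ∑ i, f (s i) = ∑ i, f (s (i + 1)) :=
    (Equiv.sum_comp (Equiv.addRight (1 : Fin n)) fun i => f (s i)).symm
  rw [h1, ← Finset.add_sum_erase _ _ (Finset.mem_univ (lastIdx n)),
    ← Finset.add_sum_erase (a := lastIdx n) _ (fun i => f (s (i + 1))) (Finset.mem_univ _),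
    lastIdx_add_one]
  have h2 : ∑ i ∈ Finset.univ.erase (lastIdx n), f (next s i) =
      ∑ i ∈ Finset.univ.erase (lastIdx n), f (s (i + 1)) :=
    Finset.sum_congr rfl fun i hi => by
      rw [next_apply_of_ne]
      exact fun h => (Finset.ne_of_mem_erase hi) ((add_one_eq_zero_iff i).1 h)
  rw [h2]; ring

/-- A step replaces, up to order, the first symbol `s 0` and the depth by the new depth and the
predecessor of the new last symbol. -/
theorem next_cases (s : Fin n → ZMod k) :
    (s 0 = depth (diffArray (next s)) ∧ depth (diffArray s) = next s (lastIdx n) - 1) ∨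
      (s 0 = next s (lastIdx n) - 1 ∧ depth (diffArray s) = depth (diffArray (next s))) := by
  have hp := congrArg Prod.snd (transition_withDepth s)
  simp only [withDepth] at hp
  rw [← hp]
  unfold next transition withDepth
  simp only
  have hl : ∀ c : ZMod k, icr c s (lastIdx n) = s 0 + c := fun c => by
    simp [icr_apply, lastIdx_add_one]
  split_ifs with h1 h2
  · have h := h1.2
    rw [hl] at h
    exact Or.inl ⟨by simp only; linear_combination h, by simp only [hl]; linear_combination -h⟩
  · have h := h2.2
    rw [hl] at h
    exact Or.inl ⟨by simp only; linear_combination h, by simp only [hl]; linear_combination -h⟩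
  · exact Or.inr ⟨by simp only [hl]; ring, rfl⟩

/-- Writing the symbol `x` moves one unit of weight from `x - 1` to `x`. -/
theorem weight_next (s : Fin n → ZMod k) (v : ZMod k) :
    weight (next s) v - weight s v = (if next s (lastIdx n) = v then 1 else 0) -
      if next s (lastIdx n) = v + 1 then 1 else 0 := by
  unfold weight
  rw [sum_next s fun x => if x = v then 1 else 0]
  have hx : (next s (lastIdx n) = v + 1) ↔ (next s (lastIdx n) - 1 = v) := by
    rw [sub_eq_iff_eq_add]
  simp only [hx]
  rcases next_cases s with ⟨h1, h2⟩ | ⟨h1, h2⟩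
  · rw [h1, h2]; ring
  · rw [h1, h2]; ring

/-- The number of occurrences of `a` among the `l` symbols written after time `i`. -/
theorem count_factor (hk : 2 ≤ k) (i : Fin (k ^ n)) (l : ℕ) (a : ZMod k) :
    (((factor (icrWord n k) i l).count a : ℕ) : ℤ) =
      ∑ j ∈ Finset.range l, if visited n k (i.val + j + 1) (lastIdx n) = a then 1 else 0 := by
  rw [factor_icrWord hk]
  induction l with
  | zero => simp
  | succ l ih =>
    rw [List.ofFn_succ', List.concat_eq_append, List.count_append, Finset.sum_range_succ, Nat.cast_add]
    simp only [Fin.val_castSucc, Fin.val_last]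
    rw [ih, List.count_singleton]
    simp

theorem count_sub_count_succ (hk : 2 ≤ k) (i : Fin (k ^ n)) (l : ℕ) (v : ZMod k) :
    ((factor (icrWord n k) i l).count v : ℤ) - (factor (icrWord n k) i l).count (v + 1) =
      weight (visited n k (i.val + l)) v - weight (visited n k i.val) v := by
  rw [count_factor hk, count_factor hk]
  induction l with
  | zero => simp
  | succ l ih =>
    rw [Finset.sum_range_succ, Finset.sum_range_succ, ← add_assoc i.val, visited_succ]
    linear_combination ih - weight_next (visited n k (i.val + l)) v

theorem count_sub_count (hk : 2 ≤ k) (i : Fin (k ^ n)) (l : ℕ) (v : ZMod k) (m : ℕ) :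
    ((factor (icrWord n k) i l).count v : ℤ) - (factor (icrWord n k) i l).count (v + m) =
      ∑ u ∈ Finset.range m, (weight (visited n k (i.val + l)) (v + u) -
        weight (visited n k i.val) (v + u)) := by
  induction m with
  | zero => simp
  | succ m ih =>
    rw [Finset.sum_range_succ, ← ih, ← count_sub_count_succ hk]
    push_cast
    rw [add_assoc]
    ring

theorem count_sub_count_le (hk : 2 ≤ k) (i : Fin (k ^ n)) (l : ℕ) (a c : ZMod k) :
    (factor (icrWord n k) i l).count a ≤ (factor (icrWord n k) i l).count c + (n + 1) := by
  have h := count_sub_count hk i l a (c - a).val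
  rw [ZMod.natCast_val, ZMod.cast_id, add_sub_cancel] at h
  have h1 : ∑ u ∈ Finset.range (c - a).val, (weight (visited n k (i.val + l)) (a + u) -
      weight (visited n k i.val) (a + u)) ≤
      ∑ u ∈ Finset.range (c - a).val, weight (visited n k (i.val + l)) (a + u) :=
    Finset.sum_le_sum fun u _ => by
      have := weight_nonneg (visited n k i.val) (a + u)
      omega
  have h2 : ∑ u ∈ Finset.range (c - a).val, weight (visited n k (i.val + l)) (a + u) ≤
      ∑ v, weight (visited n k (i.val + l)) v := by
    rw [← Finset.sum_image (f := weight (visited n k (i.val + l)))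
      (g := fun u : ℕ => a + (u : ZMod k))]
    · exact Finset.sum_le_sum_of_subset_of_nonneg (Finset.subset_univ _)
        fun v _ _ => weight_nonneg _ v
    · intro x hx y hy hxy
      have hlt := ZMod.val_lt (c - a)
      have hx' := Finset.mem_range.1 (Finset.mem_coe.1 hx)
      have hy' := Finset.mem_range.1 (Finset.mem_coe.1 hy)
      have := congrArg ZMod.val (add_left_cancel hxy)
      rwa [ZMod.val_natCast_of_lt (by omega), ZMod.val_natCast_of_lt (by omega)] at this
  rw [sum_weight] at h2
  omega

theorem discrepancy_le {N : ℕ} {w : Fin N → ZMod k} {D : ℕ}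
    (h : ∀ i l a c, (factor w i l).count a ≤ (factor w i l).count c + D) : discrepancy w ≤ D := by
  refine Finset.sup_le fun i _ => Finset.sup_le fun l _ => ?_
  unfold difference
  obtain ⟨a, -, ha⟩ := Finset.exists_mem_eq_sup' (Finset.univ_nonempty (α := ZMod k))
    fun a => (factor w i l).count a
  obtain ⟨c, -, hc⟩ := Finset.exists_mem_eq_inf' (Finset.univ_nonempty (α := ZMod k))
    fun a => (factor w i l).count a
  rw [ha, hc]
  have := h i l a c
  omega

theorem discrepancy_icrWord_le (hk : 2 ≤ k) : discrepancy (icrWord n k) ≤ n + 1 :=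
  discrepancy_le (count_sub_count_le hk)

/-- The string `0 … 0` shows that `n` is a lower bound. -/
theorem le_discrepancy (hk : 2 ≤ k) {N : ℕ} {w : Fin N → ZMod k} (hw : IsDeBruijn n w) :
    n ≤ discrepancy w := by
  have : Fact (1 < k) := ⟨hk⟩
  obtain ⟨i, hi, -⟩ := hw.occurs_once (List.replicate n 0) List.length_replicate
  have hN : n ≤ N := by
    rw [hw.length_eq, ZMod.card]
    exact (Nat.lt_pow_self hk).le
  have h1 : difference (factor w i n) ≤ discrepancy w :=
    (Finset.le_sup (f := fun l => difference (factor w i l))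
      (Finset.mem_range.2 (Nat.lt_succ_of_le hN))).trans
    (Finset.le_sup (f := fun i => (Finset.range (N + 1)).sup fun l => difference (factor w i l))
      (Finset.mem_univ i))
  refine le_trans ?_ h1
  unfold difference
  rw [show factor w i n = _ from hi]
  have h2 := Finset.le_sup' (fun a : ZMod k => (List.replicate n 0).count a) (Finset.mem_univ 0)
  have h3 := Finset.inf'_le (fun a : ZMod k => (List.replicate n 0).count a) (Finset.mem_univ 1)
  simp only [List.count_replicate_self] at h2
  rw [List.count_replicate, if_neg (by simp)] at h3
  omega

end Word

/-! ### The binary alphabet -/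

section Binary

variable {n : ℕ} [NeZero n]

theorem weight_add_weight (s : Fin n → ZMod 2) (a : ZMod 2) :
    weight s a + weight s (a + 1) = n + 1 := by
  rw [← sum_weight s]
  have : (Finset.univ : Finset (ZMod 2)) = {a, a + 1} := by revert a; decide
  rw [this, Finset.sum_pair]
  revert a; decide

/-- If all the weight is on one symbol, that symbol is `0`, since constant strings have
depth `0`. -/
theorem eq_zero_of_weight_eq_zero {s : Fin n → ZMod 2} {a : ZMod 2} (h : weight s (a + 1) = 0) :
    a = 0 := by
  have hs : ∀ b : ZMod 2, b ≠ a + 1 → b = a := by clear h; revert a; decide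
  unfold weight at h
  have h1 : (0 : ℤ) ≤ ∑ i, if s i = a + 1 then 1 else 0 :=
    Finset.sum_nonneg fun i _ => by split_ifs <;> norm_num
  have hd : depth (diffArray s) ≠ a + 1 := fun hd => by rw [if_pos hd] at h; omega
  rw [if_neg hd, add_zero, Finset.sum_eq_zero_iff_of_nonneg
    (fun i _ => by split_ifs <;> norm_num)] at h
  have hconst : ∀ i, s i = a := fun i => hs _ fun hi => by simpa [hi] using h i (Finset.mem_univ i)
  have : diffArray s = diffArray fun _ : Fin n => (0 : ZMod 2) := by
    funext i
    simp [diffArray_apply, hconst]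
  rw [← hs _ hd, this, depth_zero]

theorem discrepancy_icrWord_two : discrepancy (icrWord n 2) = n := by
  refine le_antisymm (discrepancy_le fun i l a c => ?_)
    (le_discrepancy le_rfl (isDeBruijn_icrWord le_rfl))
  rcases eq_or_ne c a with rfl | hne
  · omega
  obtain rfl : c = a + 1 := by revert a c; decide
  have h := count_sub_count_succ le_rfl i l a
  have h0 := weight_nonneg (visited n 2 i.val) a
  have h1 := weight_nonneg (visited n 2 (i.val + l)) (a + 1)
  have h2 := weight_add_weight (visited n 2 (i.val + l)) a
  have haa : a + 1 + 1 = a := by rw [add_assoc]; simp [CharTwo.add_self_eq_zero]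
  -- a difference of `n + 1` would need all the weight on `a` at one time and on `a + 1` at another
  by_contra hlt
  have e1 : weight (visited n 2 (i.val + l)) (a + 1) = 0 := by omega
  have e2 : weight (visited n 2 i.val) (a + 1 + 1) = 0 := by rw [haa]; omega
  have := eq_zero_of_weight_eq_zero e1
  have := eq_zero_of_weight_eq_zero e2
  simp_all

end Binary

/-! ### Recognizing minimal rotations in linear time -/

section Necklace

/-- The sequence `B` shifted by `t` is smaller than `B`, with the first difference at `o`. -/
def Lesser (B : ℕ → ℕ) (t o : ℕ) : Prop := (∀ x < o, B (t + x) = B x) ∧ B (t + o) < B o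

/-- The invariant of Duval's algorithm after `j` symbols: `q` is the smallest period of
`B 0, …, B (j - 1)`, and no suffix of this word is smaller than the prefix of the same length. -/
structure DuvalInv (B : ℕ → ℕ) (q j : ℕ) : Prop where
  pos : 1 ≤ q
  le : q ≤ j
  period : ∀ i, q ≤ i → i < j → B i = B (i - q)
  smallest : ∀ t, 0 < t → t < q → ∃ x, t + x < j ∧ B (t + x) ≠ B x
  not_lesser : ∀ t o, 1 ≤ t → t + o < j → ¬ Lesser B t o

theorem DuvalInv.init (B : ℕ → ℕ) : DuvalInv B 1 1 where
  pos := le_rfl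
  le := le_rfl
  period := fun i h h' => by omega
  smallest := fun t h h' => by omega
  not_lesser := fun t o h h' => by omega

/-- A suffix that agrees with a prefix can be moved to the left by the period. -/
theorem DuvalInv.shift {B : ℕ → ℕ} {q j t : ℕ} (h : DuvalInv B q j) (hqt : q < t) (htj : t ≤ j)
    (heq : ∀ x < j - t, B (t + x) = B x) : B (j - t) ≤ B (j - q) := by
  by_contra hlt
  refine h.not_lesser (t - q) (j - t) (by omega) (by have := h.pos; omega) ⟨fun x hx => ?_, ?_⟩
  · rw [← heq x hx, h.period (t + x) (by omega) (by omega)]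
    congr 1; omega
  · rw [show t - q + (j - t) = j - q by omega]
    omega

theorem DuvalInv.not_lesser_succ {B : ℕ → ℕ} {q j : ℕ} (h : DuvalInv B q j)
    (hle : B (j - q) ≤ B j) (t o : ℕ) (ht : 1 ≤ t) (hto : t + o < j + 1) : ¬ Lesser B t o := by
  rintro ⟨h1, h2⟩
  rcases Nat.lt_or_ge (t + o) j with hlt | hge
  · exact h.not_lesser t o ht hlt ⟨h1, h2⟩
  obtain rfl : o = j - t := by omega
  rw [show t + (j - t) = j by omega] at h2
  rcases lt_trichotomy t q with htq | rfl | hqt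
  · obtain ⟨x, hx, hne⟩ := h.smallest t ht htq
    exact hne (h1 x (by omega))
  · omega
  · have := h.shift hqt (by omega) h1
    omega

theorem DuvalInv.step_eq {B : ℕ → ℕ} {q j : ℕ} (h : DuvalInv B q j) (he : B j = B (j - q)) :
    DuvalInv B q (j + 1) where
  pos := h.pos
  le := by have := h.le; omega
  period := fun i hi hij => by
    rcases Nat.lt_or_ge i j with hlt | hge
    · exact h.period i hi hlt
    · obtain rfl : i = j := by omega
      exact he
  smallest := fun t ht htq => by
    obtain ⟨x, hx, hne⟩ := h.smallest t ht htq
    exact ⟨x, by omega, hne⟩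
  not_lesser := h.not_lesser_succ he.ge

theorem DuvalInv.step_gt {B : ℕ → ℕ} {q j : ℕ} (h : DuvalInv B q j) (hlt : B (j - q) < B j) :
    DuvalInv B (j + 1) (j + 1) where
  pos := by omega
  le := le_rfl
  period := fun i hi hij => by omega
  smallest := fun t ht htj => by
    by_contra! hall
    rcases Nat.lt_or_ge t q with htq | hqt
    · obtain ⟨x, hx, hne⟩ := h.smallest t ht htq
      exact hne (hall x (by omega))
    have hj := hall (j - t) (by omega)
    rw [show t + (j - t) = j by omega] at hj
    rcases Nat.eq_or_lt_of_le hqt with rfl | hqt'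
    · omega
    · have := h.shift hqt' (by omega) fun x hx => hall x (by omega)
      omega
  not_lesser := h.not_lesser_succ hlt.le

theorem DuvalInv.lesser {B : ℕ → ℕ} {q j : ℕ} (h : DuvalInv B q j) (hlt : B j < B (j - q)) :
    Lesser B q (j - q) := by
  have := h.le
  refine ⟨fun x hx => ?_, ?_⟩
  · rw [h.period (q + x) (by omega) (by omega)]
    congr 1; omega
  · rwa [show q + (j - q) = j by omega]

end Necklace

section Cyclic

open scoped Fin.CommRing

variable {n k : ℕ} [NeZero n] [NeZero k]

/-- The periodic continuation of an array, as a sequence of numbers. -/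
def periodicSeq (b : Fin n → ZMod k) (j : ℕ) : ℕ := (b (j : Fin n)).val

theorem periodicSeq_add_length (b : Fin n → ZMod k) (j : ℕ) :
    periodicSeq b (j + n) = periodicSeq b j := by
  simp [periodicSeq]

theorem periodicSeq_val (b : Fin n → ZMod k) (j : Fin n) : periodicSeq b j.val = (b j).val := by
  simp [periodicSeq]

theorem periodicSeq_rot (d : Fin n → ZMod k) (i : Fin n) (j : ℕ) :
    periodicSeq (rot d i) j = periodicSeq d (i.val + j) := by
  simp [periodicSeq, rot, add_comm]

theorem lexLT_rot_of_lesser {b : Fin n → ZMod k} {t o : ℕ} (h : Lesser (periodicSeq b) t o) :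
    LexLT (rot b (t : Fin n)) b := by
  have hrot : ∀ j : Fin n, (rot b (t : Fin n) j).val = periodicSeq b (t + j.val) := fun j => by
    simp [periodicSeq, rot, add_comm]
  have ho : o < n := by
    by_contra hge
    have e1 : t + o = t + (o - n) + n := by omega
    have e2 : o = o - n + n := by omega
    have h2 := h.2
    rw [e1, periodicSeq_add_length, h.1 _ (by have := NeZero.pos n; omega),
      ← periodicSeq_add_length, ← e2] at h2
    exact lt_irrefl _ h2
  refine ⟨⟨o, ho⟩, fun j hj => ZMod.val_injective k ?_, ?_⟩
  · rw [hrot, h.1 _ (Fin.lt_def.1 hj), periodicSeq_val]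
  · rw [hrot, ← periodicSeq_val]
    exact h.2

theorem exists_lesser {b : Fin n → ZMod k} {r : Fin n} (h : LexLT (rot b r) b) :
    ∃ t o, 1 ≤ t ∧ t + o < 2 * n ∧ Lesser (periodicSeq b) t o := by
  obtain ⟨m, h1, h2⟩ := h
  have hrot : ∀ j : Fin n, (rot b r j).val = periodicSeq b (r.val + j.val) := fun j => by
    simp [periodicSeq, rot, add_comm]
  refine ⟨r.val, m.val, ?_, by omega, fun x hx => ?_, ?_⟩
  · by_contra h0
    have : r = 0 := Fin.ext (by rw [Fin.val_zero]; omega)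
    rw [this, rot_zero] at h2
    exact lt_irrefl _ h2
  · have := h1 ⟨x, hx.trans m.isLt⟩ (Fin.lt_def.2 hx)
    have e := hrot ⟨x, hx.trans m.isLt⟩
    rw [this, ← periodicSeq_val] at e
    exact e.symm
  · rwa [hrot, ← periodicSeq_val b m] at h2

/-- What the program computes: with `i` the start of the run of zeros before the last entry,
the array is admissible if and only if its last entry is nonzero, `i ≠ 0`, and no rotation is
smaller than the one starting at `i`. -/
theorem admissible_iff {d : Fin n → ZMod k} {i : Fin n}
    (h0 : ∀ x, i.val ≤ x → x < n - 1 → periodicSeq d x = 0)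
    (h1 : i.val ≠ 0 → periodicSeq d (i.val - 1) ≠ 0) :
    Admissible d ↔ periodicSeq d (n - 1) ≠ 0 ∧ i.val ≠ 0 ∧
      ¬ ∃ t o, Lesser (periodicSeq (rot d i)) t o := by
  have hz : ∀ j : Fin n, periodicSeq d j.val = 0 ↔ d j = 0 := fun j => by
    rw [periodicSeq_val, ZMod.val_eq_zero]
  have hlast : periodicSeq d (n - 1) = 0 ↔ d (lastIdx n) = 0 := hz (lastIdx n)
  have hsub : ∀ j : Fin n, j ≠ 0 → (j - 1).val = j.val - 1 := fun j hj =>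
    Fin.val_sub_one_of_ne_zero hj
  have hne : ∀ j : Fin n, j.val ≠ 0 ↔ j ≠ 0 := fun j => by
    rw [Ne, Ne, Fin.ext_iff]; simp
  constructor
  · rintro ⟨hl, j, hj0, hj1, hj2, hj3⟩
    have hij : i = j := by
      rcases lt_trichotomy i j with h | h | h
      · exfalso
        refine hj1 ((hz _).1 ?_)
        rw [hsub j hj0]
        have := Fin.lt_def.1 h
        exact h0 _ (by omega) (by omega)
      · exact h
      · exfalso
        have hlt := Fin.lt_def.1 h
        have hi0 : i.val ≠ 0 := by omega
        have := h1 hi0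
        rw [← hsub i ((hne i).1 hi0)] at this
        refine this ((hz _).2 (hj2 _ ?_ ?_))
        · rw [Fin.le_def, hsub i ((hne i).1 hi0)]; omega
        · rw [Fin.lt_def, hsub i ((hne i).1 hi0)]; simp only [lastIdx]; omega
    subst hij
    refine ⟨fun h => hl (hlast.1 h), (hne i).2 hj0, ?_⟩
    rintro ⟨t, o, h⟩
    have := lexLT_rot_of_lesser h
    rw [rot_rot] at this
    exact hj3 _ this
  · rintro ⟨hl, hi0, hno⟩
    refine ⟨fun h => hl (hlast.2 h), i, (hne i).1 hi0, fun h => ?_, fun j hj hj' => ?_, ?_⟩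
    · refine h1 hi0 ?_
      rw [← hsub i ((hne i).1 hi0)]
      exact (hz _).2 h
    · exact (hz j).1 (h0 _ (Fin.le_def.1 hj) (Fin.lt_def.1 hj'))
    · intro r hr
      refine hno ?_
      have hr' : LexLT (rot (rot d i) (r - i)) (rot d i) := by
        rwa [rot_rot, sub_add_cancel]
      obtain ⟨t, o, -, -, h⟩ := exists_lesser hr'
      exact ⟨t, o, h⟩

end Cyclic

/-! ### Reasoning about programs -/

section Logic

variable {S W : ℕ}

/-- Run the programs of a list one after the other. -/
def Prog.block : List Prog → Prog
  | [] => .skip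
  | p :: l => .seq p (block l)

/-- An upper bound on the number of steps of a program without loops. -/
def Prog.cost : Prog → ℕ
  | .seq p q => p.cost + q.cost
  | .ite _ p q => p.cost + q.cost + 1
  | _ => 1

/-- Started in the state `s`, the program `p` halts within `m` steps, without output, in a state
with the property `Q`. -/
def Runs (S W : ℕ) (p : Prog) (s : State) (m : ℕ) (Q : State → Prop) : Prop :=
  ∃ a s', a ≤ m ∧ Exec S W p s (List.replicate a none) s' ∧ Q s'

/-- The weakest precondition for a loop-free program to halt without output in a state
with the property `Q`. -/
def wp (S W : ℕ) : Prog → (State → Prop) → State → Prop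
  | .skip, Q, s => Q s
  | .const r c, Q, s => c < W ∧ Q (s.setReg r c)
  | .copy r a, Q, s => Q (s.setReg r (s.reg a))
  | .add r a b, Q, s => s.reg a + s.reg b < W ∧ Q (s.setReg r (s.reg a + s.reg b))
  | .sub r a b, Q, s => Q (s.setReg r (s.reg a - s.reg b))
  | .load r a, Q, s => s.reg a < S ∧ Q (s.setReg r (s.mem (s.reg a)))
  | .store a b, Q, s => s.reg a < S ∧ Q (s.setMem (s.reg a) (s.reg b))
  | .output _, _, _ => False
  | .seq p q, Q, s => wp S W p (wp S W q Q) s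
  | .ite t p q, Q, s => (t.Holds s → wp S W p Q s) ∧ (¬ t.Holds s → wp S W q Q s)
  | .while _ _, _, _ => False

theorem Runs.mono {p : Prog} {s : State} {m m' : ℕ} {Q Q' : State → Prop}
    (h : Runs S W p s m Q) (hm : m ≤ m') (hQ : ∀ s', Q s' → Q' s') : Runs S W p s m' Q' := by
  obtain ⟨a, s', ha, he, hq⟩ := h
  exact ⟨a, s', ha.trans hm, he, hQ _ hq⟩

theorem Runs.seq {p q : Prog} {s : State} {m m' : ℕ} {R Q : State → Prop}
    (hp : Runs S W p s m R) (hq : ∀ s', R s' → Runs S W q s' m' Q) :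
    Runs S W (.seq p q) s (m + m') Q := by
  obtain ⟨a, s', ha, he, hr⟩ := hp
  obtain ⟨a', s'', ha', he', hq'⟩ := hq s' hr
  refine ⟨a + a', s'', by omega, ?_, hq'⟩
  rw [List.replicate_add]
  exact .seq he he'

theorem Runs.ite {b : Test} {p q : Prog} {s : State} {m : ℕ} {Q : State → Prop}
    (hp : b.Holds s → Runs S W p s m Q) (hq : ¬ b.Holds s → Runs S W q s m Q) :
    Runs S W (.ite b p q) s (m + 1) Q := by
  by_cases hb : b.Holds s
  · obtain ⟨a, s', ha, he, h⟩ := hp hb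
    exact ⟨a + 1, s', by omega, List.replicate_succ ▸ .iteTrue q hb he, h⟩
  · obtain ⟨a, s', ha, he, h⟩ := hq hb
    exact ⟨a + 1, s', by omega, List.replicate_succ ▸ .iteFalse p hb he, h⟩

theorem runs_of_wp {p : Prog} {s : State} {Q : State → Prop} (h : wp S W p Q s) :
    Runs S W p s p.cost Q := by
  induction p generalizing s Q with
  | skip => exact ⟨1, _, le_rfl, .skip s, h⟩
  | const r c => exact ⟨1, _, le_rfl, .const s r c h.1, h.2⟩
  | copy r a => exact ⟨1, _, le_rfl, .copy s r a, h⟩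
  | add r a b => exact ⟨1, _, le_rfl, .add s r a b h.1, h.2⟩
  | sub r a b => exact ⟨1, _, le_rfl, .sub s r a b, h⟩
  | load r a => exact ⟨1, _, le_rfl, .load s r a h.1, h.2⟩
  | store a b => exact ⟨1, _, le_rfl, .store s a b h.1, h.2⟩
  | seq p q ihp ihq => exact Runs.seq (ihp h) fun s' hs' => ihq hs'
  | ite t p q ihp ihq =>
    exact Runs.ite (fun ht => (ihp (h.1 ht)).mono (Nat.le_add_right _ _) fun _ => id)
      (fun ht => (ihq (h.2 ht)).mono (Nat.le_add_left _ _) fun _ => id)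
  | _ => exact h.elim

/-- A loop whose body runs for `j = a, …, b - 1`, with the invariant `I`. -/
theorem Runs.loop {t : Test} {p : Prog} {s : State} {a b c : ℕ} (I : ℕ → State → Prop)
    (hab : a ≤ b) (h0 : I a s)
    (hstep : ∀ j s, a ≤ j → j < b → I j s → t.Holds s ∧ Runs S W p s c (I (j + 1)))
    (hend : ∀ s, I b s → ¬ t.Holds s) : Runs S W (.while t p) s ((b - a) * (c + 1) + 1) (I b) := by
  obtain ⟨r, rfl⟩ := Nat.exists_eq_add_of_le hab
  induction r generalizing a s with
  | zero => exact ⟨1, s, by omega, .whileFalse p (hend s h0), h0⟩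
  | succ r ih =>
    obtain ⟨ht, x, s', hx, he, hI⟩ := hstep a s le_rfl (by omega) h0
    have e : a + 1 + r = a + (r + 1) := by omega
    obtain ⟨y, s'', hy, he', hI'⟩ := ih (a := a + 1) (s := s') hI
      (by omega) (fun j s h1 h2 => hstep j s (by omega) (by omega)) (by rwa [e])
    rw [e] at hI'
    refine ⟨x + y + 1, s'', ?_, ?_, hI'⟩
    · rw [show a + 1 + r - (a + 1) = r by omega] at hy
      rw [show a + (r + 1) - a = r + 1 by omega, Nat.succ_mul]
      omega
    · rw [List.replicate_succ, List.replicate_add]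
      exact .whileTrue ht he he'

theorem reg_setReg (s : State) (r v r' : ℕ) :
    (s.setReg r v).reg r' = if r' = r then v else s.reg r' :=
  Function.update_apply _ _ _ _

theorem mem_setReg (s : State) (r v : ℕ) : (s.setReg r v).mem = s.mem := rfl

theorem reg_setMem (s : State) (i v : ℕ) : (s.setMem i v).reg = s.reg := rfl

theorem mem_setMem (s : State) (i v j : ℕ) :
    (s.setMem i v).mem j = if j = i then v else s.mem j :=
  Function.update_apply _ _ _ _

/-! ### Spacing of the outputs -/

/-- In a trace that is preceded by `c` steps without output, there are never `T` consecutive steps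
without output. -/
def Spaced (T : ℕ) : ℕ → List (Option ℕ) → Prop
  | _, [] => True
  | c, none :: t => c + 1 < T ∧ Spaced T (c + 1) t
  | _, some _ :: t => Spaced T 0 t

theorem Spaced.mono {T c c' : ℕ} {t : List (Option ℕ)} (h : Spaced T c t) (hc : c' ≤ c) :
    Spaced T c' t := by
  induction t generalizing c c' with
  | nil => trivial
  | cons x t ih =>
    cases x with
    | none => exact ⟨by have := h.1; omega, ih h.2 (by omega)⟩
    | some v => exact h

theorem spaced_replicate {T c a : ℕ} {t : List (Option ℕ)} (h : Spaced T (c + a) t)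
    (ha : c + a < T) : Spaced T c (List.replicate a none ++ t) := by
  induction a generalizing c with
  | zero => exact h
  | succ a ih =>
    exact ⟨by omega, ih (by rwa [show c + 1 + a = c + (a + 1) by omega]) (by omega)⟩

theorem Spaced.of_append {T c : ℕ} {t t' : List (Option ℕ)} (h : Spaced T c (t ++ t')) :
    Spaced T 0 t' := by
  induction t generalizing c with
  | nil => exact h.mono (Nat.zero_le _)
  | cons x t ih =>
    cases x with
    | none => exact ih h.2
    | some v => exact ih h

theorem Spaced.exists_output {T c : ℕ} {u t : List (Option ℕ)} (h : Spaced T c (u ++ t))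
    (hc : c < T) (hu : T ≤ c + u.length) : ∃ v, some v ∈ u := by
  induction u generalizing c with
  | nil => simp at hu; omega
  | cons x u ih =>
    cases x with
    | none =>
      obtain ⟨v, hv⟩ := ih h.2 h.1 (by simp at hu; omega)
      exact ⟨v, List.mem_cons_of_mem _ hv⟩
    | some v => exact ⟨v, List.mem_cons_self⟩

theorem Spaced.infix {T c : ℕ} (hT : 0 < T) {t u : List (Option ℕ)} (h : Spaced T c t)
    (hu : u <:+: t) (hlen : T ≤ u.length) : ∃ v, some v ∈ u := by
  obtain ⟨x, y, rfl⟩ := hu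
  rw [List.append_assoc] at h
  exact h.of_append.exists_output hT (by omega)

end Logic

/-! ### The admissibility test -/

section Test

open scoped Fin.CommRing

variable {n k : ℕ} [NeZero n] [NeZero k] {S W : ℕ}

/-- The registers below `9` hold the values given by `g`; the others are scratch registers. -/
def Keeps (g : ℕ → ℕ) (s : State) : Prop := ∀ r < 9, s.reg r = g r

theorem keeps_setReg {g : ℕ → ℕ} {s : State} {r v : ℕ} (hr : 9 ≤ r) :
    Keeps g (s.setReg r v) ↔ Keeps g s := by
  refine forall₂_congr fun r' hr' => ?_
  rw [reg_setReg, if_neg (by omega)]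

theorem keeps_setMem {g : ℕ → ℕ} {s : State} {i v : ℕ} :
    Keeps g (s.setMem i v) ↔ Keeps g s := Iff.rfl

/-- Register `0` holds `n`, register `1` holds `k`, and the registers `4`, `5`, `6` hold the
constants `1`, `0`, `n - 1`. -/
structure Constants (n k : ℕ) (g : ℕ → ℕ) : Prop where
  r0 : g 0 = n
  r1 : g 1 = k
  r4 : g 4 = 1
  r5 : g 5 = 0
  r6 : g 6 = n - 1

theorem Keeps.r0 {g : ℕ → ℕ} {s : State} (h : Keeps g s) (hg : Constants n k g) :
    s.reg 0 = n := (h 0 (by norm_num)).trans hg.r0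
theorem Keeps.r1 {g : ℕ → ℕ} {s : State} (h : Keeps g s) (hg : Constants n k g) :
    s.reg 1 = k := (h 1 (by norm_num)).trans hg.r1
theorem Keeps.r4 {g : ℕ → ℕ} {s : State} (h : Keeps g s) (hg : Constants n k g) :
    s.reg 4 = 1 := (h 4 (by norm_num)).trans hg.r4
theorem Keeps.r5 {g : ℕ → ℕ} {s : State} (h : Keeps g s) (hg : Constants n k g) :
    s.reg 5 = 0 := (h 5 (by norm_num)).trans hg.r5
theorem Keeps.r6 {g : ℕ → ℕ} {s : State} (h : Keeps g s) (hg : Constants n k g) :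
    s.reg 6 = n - 1 := (h 6 (by norm_num)).trans hg.r6

theorem val_sub_eq (a b : ZMod k) :
    (a - b).val = if a.val < b.val then a.val + k - b.val else a.val - b.val := by
  split_ifs with h
  · have hb := ZMod.val_lt b
    have : a - b = ((a.val + k - b.val : ℕ) : ZMod k) := by
      rw [Nat.cast_sub (by omega)]
      simp
    rw [this, ZMod.val_natCast_of_lt (by omega)]
  · exact ZMod.val_sub (by omega)

theorem val_add_one_eq (hk : 2 ≤ k) (a : ZMod k) :
    (a + 1).val = if a.val + 1 = k then 0 else a.val + 1 := by
  have : Fact (1 < k) := ⟨hk⟩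
  have ha := ZMod.val_lt a
  rw [ZMod.val_add, ZMod.val_one]
  split_ifs with h
  · rw [h, Nat.mod_self]
  · exact Nat.mod_eq_of_lt (by omega)

theorem val_sub_one_eq (hk : 2 ≤ k) (a : ZMod k) :
    (a - 1).val = if a.val = 0 then k - 1 else a.val - 1 := by
  have : Fact (1 < k) := ⟨hk⟩
  rw [val_sub_eq, ZMod.val_one]
  split_ifs <;> omega

/-- The minuends of the entries of the difference array. -/
def prevSeq (u : Fin n → ZMod k) : ℕ → ℕ
  | 0 => (u (lastIdx n) - 1).val
  | j + 1 => periodicSeq u j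

theorem prevSeq_lt (u : Fin n → ZMod k) (j : ℕ) : prevSeq u j < k := by
  cases j <;> exact ZMod.val_lt _

theorem periodicSeq_diffArray (u : Fin n → ZMod k) {j : ℕ} (hj : j < n) :
    periodicSeq (diffArray u) j = if prevSeq u j < periodicSeq u j
      then prevSeq u j + k - periodicSeq u j else prevSeq u j - periodicSeq u j := by
  have hl : (-1 : Fin n) = lastIdx n := by rw [← add_one_eq_zero_iff]; simp
  cases j with
  | zero =>
    refine (congrArg ZMod.val ?_).trans (val_sub_eq (u (lastIdx n) - 1) (u ((0 : ℕ) : Fin n)))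
    rw [diffArray_apply]
    simp only [Nat.cast_zero, zero_sub, hl, if_true]
    ring
  | succ j =>
    refine (congrArg ZMod.val ?_).trans (val_sub_eq (u (j : Fin n)) (u ((j + 1 : ℕ) : Fin n)))
    have hne : ((j + 1 : ℕ) : Fin n) ≠ 0 := fun h => by
      have := congrArg Fin.val h
      rw [Fin.val_natCast, Nat.mod_eq_of_lt hj] at this
      simp at this
    rw [diffArray_apply, if_neg hne, sub_zero]
    push_cast
    rw [add_sub_cancel_right]

/-- The body of the loop of `diffProg`. -/
def diffBody : Prog := .block
  [.load 12 10, .ite (.lt 11 12) (.block [.add 13 11 1, .sub 13 13 12]) (.sub 13 11 12),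
    .add 14 10 0, .store 14 13, .add 14 14 0, .store 14 13, .add 14 14 0, .store 14 13,
    .copy 11 12, .add 10 10 4]

/-- Write three consecutive copies of the difference array of the string in the cells
`0, …, n - 1` behind it, so that indices need not be reduced modulo `n`. -/
def diffProg : Prog := .seq
  (.block [.copy 10 5, .load 11 6, .ite (.eq 11 5) (.sub 11 1 4) (.sub 11 11 4)])
  (.while (.lt 10 0) diffBody)

/-- The loop invariant of `diffProg`. -/
def DiffInv (g : ℕ → ℕ) (u : Fin n → ZMod k) (j : ℕ) (s : State) : Prop :=
  Keeps g s ∧ s.reg 10 = j ∧ s.reg 11 = prevSeq u j ∧ (∀ x < n, s.mem x = periodicSeq u x) ∧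
    ∀ x < j, s.mem (n + x) = periodicSeq (diffArray u) x ∧
      s.mem (n + n + x) = periodicSeq (diffArray u) x ∧
      s.mem (n + n + n + x) = periodicSeq (diffArray u) x

theorem diffBody_runs (hS : 4 * n ≤ S) (hW : 4 * n + 2 * k ≤ W) {g : ℕ → ℕ}
    (hg : Constants n k g) {u : Fin n → ZMod k} {j : ℕ} (hj : j < n) {s : State}
    (h : DiffInv g u j s) : Runs S W diffBody s 15 (DiffInv g u (j + 1)) := by
  obtain ⟨hs, h10, h11, hu, hd⟩ := h
  refine (runs_of_wp ?_).mono (by simp [diffBody, Prog.block, Prog.cost]) fun _ => id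
  have hlt := prevSeq_lt u j
  have hdj := periodicSeq_diffArray u hj
  simp only [diffBody, DiffInv, Prog.block, wp, Test.Holds, reg_setReg, mem_setReg, reg_setMem, mem_setMem,
    Nat.reduceEqDiff, if_true, if_false, h10, h11, hs.r0 hg, hs.r1 hg, hs.r4 hg, hu j hj]
  have hmem : (∀ x < n, (if x = j + n + n + n then periodicSeq (diffArray u) j else
      if x = j + n + n then periodicSeq (diffArray u) j else
      if x = j + n then periodicSeq (diffArray u) j else s.mem x) = periodicSeq u x) ∧
      ∀ x < j + 1, ∀ y, y = n + x ∨ y = n + n + x ∨ y = n + n + n + x →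
      (if y = j + n + n + n then periodicSeq (diffArray u) j else
      if y = j + n + n then periodicSeq (diffArray u) j else
      if y = j + n then periodicSeq (diffArray u) j else s.mem y) =
        periodicSeq (diffArray u) x := by
    refine ⟨fun x hx => ?_, fun x hx y hy => ?_⟩
    · rw [if_neg (by omega), if_neg (by omega), if_neg (by omega)]
      exact hu x hx
    · rcases Nat.eq_or_lt_of_le (Nat.le_of_lt_succ hx) with rfl | hx'
      · split_ifs <;> first | rfl | omega
      · rw [if_neg (by omega), if_neg (by omega), if_neg (by omega)]
        rcases hy with rfl | rfl | rfl
        · exact (hd x hx').1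
        · exact (hd x hx').2.1
        · exact (hd x hx').2.2
  refine ⟨by omega, fun hl => ?_, fun hl => ?_⟩
  · rw [if_pos hl] at hdj
    simp only [← hdj]
    refine ⟨by omega, by omega, by omega, by omega, by omega, by omega, by omega, by omega, ?_,
      trivial, rfl, hmem.1, fun x hx => ⟨hmem.2 x hx _ (.inl rfl), hmem.2 x hx _ (.inr (.inl rfl)),
        hmem.2 x hx _ (.inr (.inr rfl))⟩⟩
    simp [keeps_setReg, keeps_setMem, hs]
  · rw [if_neg hl] at hdj
    simp only [← hdj]
    refine ⟨by omega, by omega, by omega, by omega, by omega, by omega, by omega, ?_,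
      trivial, rfl, hmem.1, fun x hx => ⟨hmem.2 x hx _ (.inl rfl), hmem.2 x hx _ (.inr (.inl rfl)),
        hmem.2 x hx _ (.inr (.inr rfl))⟩⟩
    simp [keeps_setReg, keeps_setMem, hs]

theorem diffProg_runs (hk : 2 ≤ k) (hS : 4 * n ≤ S) (hW : 4 * n + 2 * k ≤ W) {g : ℕ → ℕ}
    (hg : Constants n k g) {u : Fin n → ZMod k} {s : State} (hs : Keeps g s)
    (hu : ∀ x < n, s.mem x = periodicSeq u x) :
    Runs S W diffProg s (16 * n + 7) fun s' => Keeps g s' ∧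
      (∀ x < n, s'.mem x = periodicSeq u x) ∧
      ∀ x < 3 * n, s'.mem (n + x) = periodicSeq (diffArray u) x := by
  have hn := NeZero.pos n
  have hp : Runs S W (.block [.copy 10 5, .load 11 6, .ite (.eq 11 5) (.sub 11 1 4) (.sub 11 11 4)])
      s 6 (DiffInv g u 0) := by
    refine (runs_of_wp ?_).mono (by simp [Prog.block, Prog.cost]) fun _ => id
    have h0 : prevSeq u 0 = if s.mem (n - 1) = 0 then k - 1 else s.mem (n - 1) - 1 := by
      rw [hu _ (by omega), show periodicSeq u (n - 1) = _ from periodicSeq_val u (lastIdx n),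
        ← val_sub_one_eq hk]
      rfl
    simp only [DiffInv, Prog.block, wp, Test.Holds, reg_setReg, mem_setReg,
      Nat.reduceEqDiff, if_true, if_false, hs.r1 hg, hs.r4 hg, hs.r5 hg, hs.r6 hg]
    refine ⟨by omega, fun h => ?_, fun h => ?_⟩
    · simpa [keeps_setReg, hs, h, h0] using hu
    · simpa [keeps_setReg, hs, h, h0] using hu
  refine (hp.seq fun s h => (Runs.loop (DiffInv g u) (Nat.zero_le n) h (fun j s _ hj h => ⟨?_,
    diffBody_runs hS hW hg hj h⟩) fun s h => ?_).mono le_rfl fun s h => ?_).mono (by omega)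
    fun s h => h
  · show s.reg 10 < s.reg 0
    rw [h.2.1, h.1.r0 hg]
    exact hj
  · show ¬ s.reg 10 < s.reg 0
    rw [h.2.1, h.1.r0 hg]
    exact lt_irrefl _
  · refine ⟨h.1, h.2.2.2.1, fun x hx => ?_⟩
    rcases Nat.lt_or_ge x n with h1 | h1
    · exact (h.2.2.2.2 x h1).1
    rcases Nat.lt_or_ge x (n + n) with h2 | h2
    · have := (h.2.2.2.2 (x - n) (by omega)).2.1
      rwa [show n + n + (x - n) = n + x by omega, ← periodicSeq_add_length,
        Nat.sub_add_cancel h1] at this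
    · have := (h.2.2.2.2 (x - n - n) (by omega)).2.2
      rwa [show n + n + n + (x - n - n) = n + x by omega, ← periodicSeq_add_length,
        Nat.sub_add_cancel (by omega), ← periodicSeq_add_length, Nat.sub_add_cancel h1] at this

/-- Compute in register `15` the position after the last nonzero entry of the difference array, the
entry at `n - 1` disregarded. -/
def scanProg : Prog := .seq
  (.block [.copy 10 5, .copy 15 5])
  (.while (.lt 10 6) (.block
    [.add 14 10 0, .load 12 14, .add 10 10 4, .ite (.ne 12 5) (.copy 15 10) .skip]))

/-- The loop invariant of `scanProg`. -/
def ScanInv (g : ℕ → ℕ) (m D : ℕ → ℕ) (j : ℕ) (s : State) : Prop :=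
  Keeps g s ∧ s.reg 10 = j ∧ s.mem = m ∧ s.reg 15 ≤ j ∧
    (∀ x, s.reg 15 ≤ x → x < j → D x = 0) ∧ (s.reg 15 ≠ 0 → D (s.reg 15 - 1) ≠ 0)

theorem scanProg_runs (hS : 4 * n ≤ S) (hW : 4 * n + 2 * k ≤ W) {g : ℕ → ℕ}
    (hg : Constants n k g) {m D : ℕ → ℕ} {s : State} (hs : Keeps g s) (hm : s.mem = m)
    (hD : ∀ x < 3 * n, m (n + x) = D x) :
    Runs S W scanProg s (9 * n + 4) (ScanInv g m D (n - 1)) := by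
  have hn := NeZero.pos n
  have hp : Runs S W (.block [.copy 10 5, .copy 15 5]) s 3 (ScanInv g m D 0) := by
    refine (runs_of_wp ?_).mono (by simp [Prog.block, Prog.cost]) fun _ => id
    simp [ScanInv, Prog.block, wp, reg_setReg, mem_setReg, hs.r5 hg, keeps_setReg, hs, hm]
  refine (hp.seq fun s h => Runs.loop (ScanInv g m D) (Nat.zero_le _) h (c := 8)
    (fun j s _ hj h => ⟨?_, ?_⟩) fun s h => ?_).mono (by omega) fun s h => h
  · show s.reg 10 < s.reg 6
    rw [h.2.1, h.1.r6 hg]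
    exact hj
  · obtain ⟨hs, h10, hm, hle, h0, h1⟩ := h
    refine (runs_of_wp ?_).mono (by simp [Prog.block, Prog.cost]) fun _ => id
    have hDj : m (j + n) = D j := by rw [add_comm]; exact hD j (by omega)
    simp only [ScanInv, Prog.block, wp, Test.Holds, reg_setReg, mem_setReg, Nat.reduceEqDiff,
      if_true, if_false, h10, hm, hDj, hs.r0 hg, hs.r4 hg, hs.r5 hg]
    refine ⟨by omega, by omega, by omega, fun hne => ?_, fun he => ?_⟩
    · refine ⟨by simp [keeps_setReg, hs], trivial, trivial, le_rfl, fun x _ _ => by omega,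
        fun _ => hne⟩
    · refine ⟨by simp [keeps_setReg, hs], trivial, trivial, by omega, fun x hx hxj => ?_, h1⟩
      rcases Nat.eq_or_lt_of_le (Nat.le_of_lt_succ hxj) with rfl | hlt
      · exact not_not.1 he
      · exact h0 x hx hlt
  · show ¬ s.reg 10 < s.reg 6
    rw [h.2.1, h.1.r6 hg]
    exact lt_irrefl _

/-- Duval's algorithm on two periods of the rotation of the difference array that starts at the
position in register `15`; register `9` is `1` if no smaller rotation has been found, and register
`16` holds the period. -/
def duvalProg : Prog := .seq
  (.block [.copy 16 4, .copy 10 4, .add 17 0 0, .copy 9 4, .add 18 15 0])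
  (.while (.lt 10 17) (.block
    [.add 14 18 10, .load 12 14, .sub 14 14 16, .load 13 14, .add 10 10 4,
      .ite (.lt 12 13) (.copy 9 5) (.ite (.lt 13 12) (.copy 16 10) .skip)]))

/-- The loop invariant of `duvalProg`. -/
def DuvalLoopInv (g : ℕ → ℕ) (m : ℕ → ℕ) (N i : ℕ) (B : ℕ → ℕ) (j : ℕ) (s : State) : Prop :=
  Keeps g s ∧ s.reg 10 = j ∧ s.reg 17 = 2 * N ∧ s.reg 18 = i + N ∧ s.reg 15 = i ∧ s.mem = m ∧
    1 ≤ s.reg 16 ∧ s.reg 16 ≤ j ∧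
    ((s.reg 9 = 1 ∧ DuvalInv B (s.reg 16) j) ∨ (s.reg 9 = 0 ∧ ∃ t o, Lesser B t o))

theorem duvalProg_runs (hS : 4 * n ≤ S) (hW : 4 * n + 2 * k ≤ W) {g : ℕ → ℕ}
    (hg : Constants n k g) {m D B : ℕ → ℕ} {i : ℕ} {s : State} (hs : Keeps g s) (hm : s.mem = m)
    (hD : ∀ x < 3 * n, m (n + x) = D x) (hi : i < n) (h15 : s.reg 15 = i)
    (hB : ∀ x, B x = D (i + x)) :
    Runs S W duvalProg s (24 * n + 7) (DuvalLoopInv g m n i B (2 * n)) := by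
  have hn := NeZero.pos n
  have hp : Runs S W (.block [.copy 16 4, .copy 10 4, .add 17 0 0, .copy 9 4, .add 18 15 0]) s 6
      (DuvalLoopInv g m n i B 1) := by
    refine (runs_of_wp ?_).mono (by simp [Prog.block, Prog.cost]) fun _ => id
    simp only [DuvalLoopInv, Prog.block, wp, reg_setReg, mem_setReg, Nat.reduceEqDiff, if_true,
      if_false, hs.r0 hg, hs.r4 hg, h15, hm]
    exact ⟨by omega, by omega, by simp [keeps_setReg, hs], trivial, by omega, trivial, trivial,
      trivial, le_rfl, le_rfl, .inl ⟨trivial, .init B⟩⟩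
  refine (hp.seq fun s h => Runs.loop (DuvalLoopInv g m n i B) (by omega) h (c := 11)
    (fun j s hj1 hj h => ⟨?_, ?_⟩) fun s h => ?_).mono (by omega) fun s h => h
  · show s.reg 10 < s.reg 17
    rw [h.2.1, h.2.2.1]
    exact hj
  · obtain ⟨hs, h10, h17, h18, h15, hm, hq1, hqj, hor⟩ := h
    refine (runs_of_wp ?_).mono (by simp [Prog.block, Prog.cost]) fun _ => id
    have e1 : m (i + n + j) = B j := by
      rw [hB, ← hD _ (by omega)]; congr 1; omega
    have e2 : m (i + n + j - s.reg 16) = B (j - s.reg 16) := by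
      rw [hB, ← hD _ (by omega)]; congr 1; omega
    simp only [DuvalLoopInv, Prog.block, wp, Test.Holds, reg_setReg, mem_setReg, Nat.reduceEqDiff,
      if_true, if_false, h10, hm, h17, h18, h15, e1, e2, hs.r4 hg, hs.r5 hg]
    refine ⟨by omega, by omega, by omega, by omega, fun hlt => ?_, fun hge => ⟨fun hgt => ?_,
      fun hle => ?_⟩⟩
    · refine ⟨by simp [keeps_setReg, hs], trivial, trivial, trivial, trivial, trivial, hq1,
        by omega, .inr ⟨trivial, ?_⟩⟩
      rcases hor with ⟨-, h⟩ | ⟨-, h⟩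
      · exact ⟨_, _, h.lesser hlt⟩
      · exact h
    · refine ⟨by simp [keeps_setReg, hs], trivial, trivial, trivial, trivial, trivial, by omega,
        le_rfl, ?_⟩
      rcases hor with ⟨h9, h⟩ | ⟨h9, h⟩
      · exact .inl ⟨h9, h.step_gt hgt⟩
      · exact .inr ⟨h9, h⟩
    · refine ⟨by simp [keeps_setReg, hs], trivial, trivial, trivial, trivial, trivial, hq1,
        by omega, ?_⟩
      rcases hor with ⟨h9, h⟩ | ⟨h9, h⟩
      · exact .inl ⟨h9, h.step_eq (by omega)⟩
      · exact .inr ⟨h9, h⟩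
  · show ¬ s.reg 10 < s.reg 17
    rw [h.2.1, h.2.2.1]
    exact lt_irrefl _

/-- Test in register `9` whether the string in the cells `0, …, n - 1` is admissible. -/
def testProg : Prog := .block [diffProg, scanProg, duvalProg,
  .block [.add 14 6 0, .load 12 14, .ite (.eq 12 5) (.copy 9 5) .skip,
    .ite (.eq 15 5) (.copy 9 5) .skip]]

theorem testProg_runs (hk : 2 ≤ k) (hS : 4 * n ≤ S) (hW : 4 * n + 2 * k ≤ W) {g : ℕ → ℕ}
    (hg : Constants n k g) {u : Fin n → ZMod k} {s : State} (hs : Keeps g s)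
    (hu : ∀ x < n, s.mem x = periodicSeq u x) :
    Runs S W testProg s (49 * n + 30) fun s' => Keeps g s' ∧
      (∀ x < n, s'.mem x = periodicSeq u x) ∧
      s'.reg 9 = if CorrectDiffArray u then 1 else 0 := by
  have hn := NeZero.pos n
  refine ((diffProg_runs hk hS hW hg hs hu).seq (m' := 9 * n + 4 + (24 * n + 7 + (9 + 1)))
    fun s1 ⟨hs1, hu1, hd1⟩ => ?_).mono (by omega) fun _ => id
  refine (scanProg_runs hS hW hg hs1 rfl hd1).seq fun s2 ⟨hs2, _, hm2, hi2, h0, h1⟩ => ?_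
  obtain ⟨i, hi⟩ : ∃ i : Fin n, s2.reg 15 = i.val := ⟨⟨s2.reg 15, by omega⟩, rfl⟩
  rw [hi] at h0 h1
  refine (duvalProg_runs (B := periodicSeq (rot (diffArray u) i)) hS hW hg hs2 hm2
    hd1 i.isLt hi fun x => periodicSeq_rot _ _ _).seq
    fun s3 ⟨hs3, _, _, _, h15, hm3, _, _, hor⟩ => ?_
  refine Runs.seq (m := 9) ((runs_of_wp ?_).mono (by simp [Prog.block, Prog.cost]) fun _ => id)
    fun s4 h => ⟨1, s4, le_rfl, .skip s4, h⟩
  have hiff := admissible_iff (d := diffArray u) (i := i) h0 h1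
  rw [← correctDiffArray_iff] at hiff
  classical
  have h9 : s3.reg 9 = if ∃ t o, Lesser (periodicSeq (rot (diffArray u) i)) t o then 0 else 1 := by
    rcases hor with ⟨h9, h⟩ | ⟨h9, h⟩
    · rw [h9, if_neg]
      rintro ⟨t, o, hlt⟩
      obtain ⟨t', o', h1, h2, h3⟩ := exists_lesser (lexLT_rot_of_lesser hlt)
      exact h.not_lesser t' o' h1 h2 h3
    · rw [h9, if_pos h]
  have hl : s1.mem (n - 1 + n) = periodicSeq (diffArray u) (n - 1) := by
    rw [add_comm]; exact hd1 _ (by omega)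
  simp only [Prog.block, wp, Test.Holds, reg_setReg, mem_setReg, Nat.reduceEqDiff, if_true,
    if_false, hs3.r0 hg, hs3.r5 hg, hs3.r6 hg, hm3, h15, hl, h9]
  refine ⟨by omega, by omega, fun hz => ⟨fun hi0 => ?_, fun hi0 => ?_⟩,
    fun hz => ⟨fun hi0 => ?_, fun hi0 => ?_⟩⟩
  · refine ⟨by simp [keeps_setReg, hs3], hu1, ?_⟩
    rw [if_neg fun h => (hiff.1 h).1 hz]
  · refine ⟨by simp [keeps_setReg, hs3], hu1, ?_⟩
    rw [if_neg fun h => (hiff.1 h).1 hz]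
  · refine ⟨by simp [keeps_setReg, hs3], hu1, ?_⟩
    rw [if_neg fun h => (hiff.1 h).2.1 hi0]
  · refine ⟨by simp [keeps_setReg, hs3], hu1, ?_⟩
    by_cases hex : ∃ t o, Lesser (periodicSeq (rot (diffArray u) i)) t o
    · rw [if_pos hex, if_neg fun h => (hiff.1 h).2.2 hex]
    · rw [if_neg hex, if_pos (hiff.2 ⟨hz, hi0, hex⟩)]

end Test

/-! ### The program -/

section Program

open scoped Fin.CommRing

variable {n k : ℕ} [NeZero n] [NeZero k] {S W : ℕ}

theorem natCast_add_one_eq_zero_iff {x : ℕ} (hx : x < n) :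
    (x : Fin n) + 1 = 0 ↔ x = n - 1 := by
  rw [add_one_eq_zero_iff, Fin.ext_iff, Fin.val_natCast, Nat.mod_eq_of_lt hx]
  rfl

theorem periodicSeq_bump (u : Fin n → ZMod k) {x : ℕ} (hx : x < n) :
    periodicSeq (bump u) x = if x = n - 1 then (u (lastIdx n) + 1).val else periodicSeq u x := by
  simp only [periodicSeq, bump, natCast_add_one_eq_zero_iff hx]
  split_ifs with h
  · rw [← add_one_eq_zero_iff (x : Fin n) |>.1 ((natCast_add_one_eq_zero_iff hx).2 h)]
  · rw [add_zero]

theorem periodicSeq_icr_zero (u : Fin n → ZMod k) {x : ℕ} (hx : x < n) :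
    periodicSeq (icr 0 u) x = if x = n - 1 then (u 0).val else periodicSeq u (x + 1) := by
  simp only [periodicSeq, icr_apply, ite_self, add_zero]
  split_ifs with h
  · rw [(natCast_add_one_eq_zero_iff hx).2 h]
  · push_cast; rfl

/-- The cells `0, …, n - 1` hold the string `u`, and the registers `2` and `8` hold `p` and the
last symbol of `u`. -/
def Holds (n k : ℕ) [NeZero n] [NeZero k] (u : Fin n → ZMod k) (p : ZMod k) (s : State) : Prop :=
  Constants n k s.reg ∧ s.reg 2 = p.val ∧ s.reg 8 = (u (lastIdx n)).val ∧
    ∀ x < n, s.mem x = periodicSeq u x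

theorem constants_iff {g : ℕ → ℕ} : Constants n k g ↔
    g 0 = n ∧ g 1 = k ∧ g 4 = 1 ∧ g 5 = 0 ∧ g 6 = n - 1 :=
  ⟨fun h => ⟨h.r0, h.r1, h.r4, h.r5, h.r6⟩, fun h => ⟨h.1, h.2.1, h.2.2.1, h.2.2.2.1, h.2.2.2.2⟩⟩

/-- Replace the string by the one in which the first symbol has moved to the end. -/
def shiftProg : Prog := .block
  [.block [.load 8 5, .copy 10 4],
    .while (.lt 10 0) (.block [.load 12 10, .sub 14 10 4, .store 14 12, .add 10 10 4]),
    .store 6 8]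

/-- The loop invariant of `shiftProg`. -/
def ShiftInv (u : Fin n → ZMod k) (p : ZMod k) (j : ℕ) (s : State) : Prop :=
  Constants n k s.reg ∧ s.reg 2 = p.val ∧ s.reg 8 = (u 0).val ∧ s.reg 10 = j ∧
    ∀ x < n, s.mem x = if x + 1 < j then periodicSeq u (x + 1) else periodicSeq u x

theorem shiftProg_runs (hS : 4 * n ≤ S) (hW : 4 * n + 2 * k ≤ W) {u : Fin n → ZMod k}
    {p : ZMod k} {s : State} (hg : Constants n k s.reg) (hp : s.reg 2 = p.val)
    (hu : ∀ x < n, s.mem x = periodicSeq u x) :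
    Runs S W shiftProg s (6 * n + 9) (Holds n k (icr 0 u) p) := by
  have hn := NeZero.pos n
  have hp : Runs S W (.block [.load 8 5, .copy 10 4]) s 3 (ShiftInv u p 1) := by
    refine (runs_of_wp ?_).mono (by simp [Prog.block, Prog.cost]) fun _ => id
    simp only [ShiftInv, Prog.block, wp, reg_setReg, mem_setReg, constants_iff, Nat.reduceEqDiff,
      if_true, if_false, hg.r0, hg.r1, hg.r4, hg.r5, hg.r6, hp, hu 0 hn]
    refine ⟨by omega, ⟨trivial, trivial, trivial, trivial, trivial⟩, trivial,
      by simpa using periodicSeq_val u 0, trivial, fun x hx => ?_⟩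
    rw [if_neg (by omega)]
    exact hu x hx
  refine (hp.seq (m' := (n - 1) * 6 + 1 + (1 + 1)) fun s h => (Runs.loop (c := 5) (ShiftInv u p)
    hn h (fun j s hj1 hj h => ⟨?_, ?_⟩) fun s h => ?_).seq fun s h => ?_).mono (by omega)
    fun s h => h
  · show s.reg 10 < s.reg 0
    rw [h.2.2.2.1, h.1.r0]
    exact hj
  · obtain ⟨hg, hp, h8, h10, hu⟩ := h
    refine (runs_of_wp ?_).mono (by simp [Prog.block, Prog.cost]) fun _ => id
    have huj := hu j hj
    rw [if_neg (by omega)] at huj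
    simp only [ShiftInv, Prog.block, wp, reg_setReg, mem_setReg, reg_setMem, mem_setMem,
      constants_iff, Nat.reduceEqDiff, if_true, if_false, hg.r0, hg.r1, hg.r4, hg.r5, hg.r6, hp,
      h8, h10, huj]
    refine ⟨by omega, by omega, by omega, ⟨trivial, trivial, trivial, trivial, trivial⟩, trivial,
      trivial, trivial, fun x hx => ?_⟩
    rw [hu x hx]
    by_cases h1 : x = j - 1
    · rw [if_pos h1, if_pos (by omega), h1, Nat.sub_add_cancel hj1]
    · rw [if_neg h1]
      by_cases h2 : x + 1 < j
      · rw [if_pos h2, if_pos (by omega)]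
      · rw [if_neg h2, if_neg (by omega)]
  · show ¬ s.reg 10 < s.reg 0
    rw [h.2.2.2.1, h.1.r0]
    exact lt_irrefl _
  · obtain ⟨hg, hp, h8, h10, hu⟩ := h
    refine (runs_of_wp ?_).mono (by simp [Prog.block, Prog.cost]) fun _ => id
    simp only [Holds, Prog.block, wp, reg_setMem, mem_setMem, hg.r6, hp, h8]
    refine ⟨by omega, hg, trivial, by simp [icr_apply, lastIdx_add_one], fun x hx => ?_⟩
    rw [periodicSeq_icr_zero u hx, hu x hx]
    split_ifs
    · rfl
    · rfl
    · omega

/-- Increment the last symbol of the string. -/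
def bumpProg : Prog := .block [.add 8 8 4, .ite (.eq 8 1) (.copy 8 5) .skip, .store 6 8]

theorem bumpProg_runs (hk : 2 ≤ k) (hS : 4 * n ≤ S) (hW : 4 * n + 2 * k ≤ W)
    {u : Fin n → ZMod k} {p : ZMod k} {s : State} (h : Holds n k u p s) :
    Runs S W bumpProg s 6 (Holds n k (bump u) p) := by
  obtain ⟨hg, hp, h8, hu⟩ := h
  have hn := NeZero.pos n
  have hlt := ZMod.val_lt (u (lastIdx n))
  refine (runs_of_wp ?_).mono (by simp [bumpProg, Prog.block, Prog.cost]) fun _ => id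
  have hmem : ∀ x < n, (if x = n - 1 then (u (lastIdx n) + 1).val else s.mem x) =
      periodicSeq (bump u) x := fun x hx => by rw [periodicSeq_bump u hx, hu x hx]
  have hb := val_add_one_eq hk (u (lastIdx n))
  simp only [Holds, bumpProg, Prog.block, wp, Test.Holds, reg_setReg, mem_setReg, reg_setMem,
    mem_setMem, constants_iff, Nat.reduceEqDiff, if_true, if_false, hg.r0, hg.r1, hg.r4, hg.r5,
    hg.r6, hp, h8, bump_lastIdx]
  refine ⟨by omega, fun he => ?_, fun he => ?_⟩
  · rw [if_pos he] at hb
    exact ⟨by omega, ⟨trivial, trivial, trivial, trivial, trivial⟩, trivial, hb.symm, hb ▸ hmem⟩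
  · rw [if_neg he] at hb
    exact ⟨by omega, ⟨trivial, trivial, trivial, trivial, trivial⟩, trivial, hb.symm, hb ▸ hmem⟩

/-- If the test `t` succeeds, test whether the string is admissible. -/
def condTestProg (t : Test) : Prog := .ite t testProg (.copy 9 5)

theorem condTestProg_runs (hk : 2 ≤ k) (hS : 4 * n ≤ S) (hW : 4 * n + 2 * k ≤ W)
    {u : Fin n → ZMod k} {p : ZMod k} {s : State} {t : Test} {P : Prop} [Decidable P]
    (h : Holds n k u p s) (ht : t.Holds s ↔ P) :
    Runs S W (condTestProg t) s (49 * n + 31) fun s' => Holds n k u p s' ∧ s'.reg 7 = s.reg 7 ∧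
      s'.reg 9 = if CorrectDiffArray u ∧ P then 1 else 0 := by
  obtain ⟨hg, hp, h8, hu⟩ := h
  refine Runs.ite (fun hb => ?_) fun hb => ?_
  · refine (testProg_runs hk hS hW hg (fun _ _ => rfl) hu).mono le_rfl fun s' ⟨hs', hu', h9⟩ => ?_
    refine ⟨⟨⟨hs'.r0 hg, hs'.r1 hg, hs'.r4 hg, hs'.r5 hg, hs'.r6 hg⟩,
      (hs' 2 (by norm_num)).trans hp, (hs' 8 (by norm_num)).trans h8, hu'⟩, hs' 7 (by norm_num), ?_⟩
    rw [h9]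
    simp [ht.1 hb]
  · refine (runs_of_wp ?_).mono (by simp [Prog.cost]) fun _ => id
    have : ¬ P := fun h => hb (ht.2 h)
    simp only [wp, Holds, reg_setReg, mem_setReg, constants_iff, Nat.reduceEqDiff, if_true,
      if_false, hg.r0, hg.r1, hg.r4, hg.r5, hg.r6, hp, h8, this, and_false]
    exact ⟨⟨⟨trivial, trivial, trivial, trivial, trivial⟩, trivial, trivial, hu⟩, trivial, trivial⟩

/-- The part of `stepProg` that is executed if the first rule does not apply. -/
def ascendProg : Prog := .block
  [bumpProg, condTestProg (.eq 8 2),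
    .ite (.eq 9 4) (.block [bumpProg, .ite (.eq 2 5) (.sub 2 1 4) (.sub 2 2 4)]) .skip]

/-- Compute one step of the transition. -/
def stepProg : Prog := .block
  [shiftProg, .block [.add 7 2 4, .ite (.eq 7 1) (.copy 7 5) .skip], condTestProg (.eq 7 8),
    .ite (.eq 9 4) (.copy 2 7) ascendProg]

theorem ascendProg_runs (hk : 2 ≤ k) (hS : 4 * n ≤ S) (hW : 4 * n + 2 * k ≤ W)
    {u : Fin n → ZMod k} {p : ZMod k} {s : State} (h : Holds n k (icr 0 u) p s) :
    Runs S W ascendProg s (49 * n + 50)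
      (if CorrectDiffArray (icr 1 u) ∧ icr 1 u (lastIdx n) = p then Holds n k (icr 2 u) (p - 1)
        else Holds n k (icr 1 u) p) := by
  have hn := NeZero.pos n
  have e1 : icr 1 u = bump (icr 0 u) := by rw [← icr_add_one, zero_add]
  have e2 : icr 2 u = bump (icr 1 u) := by rw [← icr_add_one, one_add_one_eq_two]
  refine ((bumpProg_runs hk hS hW h).seq (m' := 49 * n + 31 + (12 + 1)) fun s1 h1 => ?_).mono
    (by omega) fun _ => id
  rw [← e1] at h1
  refine (condTestProg_runs hk hS hW h1 (P := icr 1 u (lastIdx n) = p) ?_).seq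
    fun s2 ⟨h2, _, h9⟩ => Runs.seq (R := if CorrectDiffArray (icr 1 u) ∧ icr 1 u (lastIdx n) = p
      then Holds n k (icr 2 u) (p - 1) else Holds n k (icr 1 u) p) ?_
      fun s3 h => ⟨1, s3, le_rfl, .skip s3, h⟩
  · show s1.reg 8 = s1.reg 2 ↔ _
    rw [h1.2.2.1, h1.2.1, (ZMod.val_injective k).eq_iff]
  · refine Runs.ite (m := 11) (fun hb => ?_) fun hb => ?_
    · have hb' : s2.reg 9 = s2.reg 4 := hb
      rw [h9, h2.1.r4] at hb'
      have hc : CorrectDiffArray (icr 1 u) ∧ icr 1 u (lastIdx n) = p := by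
        by_contra hc
        rw [if_neg hc] at hb'
        exact zero_ne_one hb'
      rw [if_pos hc]
      refine (bumpProg_runs hk hS hW h2).seq (m' := 5) fun s3 h3 =>
        (runs_of_wp ?_).mono (by simp [Prog.block, Prog.cost]) fun _ => id
      rw [← e2] at h3
      obtain ⟨hg, hp, h8, hu⟩ := h3
      have hv := val_sub_one_eq hk p
      simp only [Holds, Prog.block, wp, Test.Holds, reg_setReg, mem_setReg, constants_iff,
        Nat.reduceEqDiff, if_true, if_false, hg.r0, hg.r1, hg.r4, hg.r5, hg.r6, hp, h8]
      refine ⟨fun he => ?_, fun he => ?_⟩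
      · rw [if_pos he] at hv
        exact ⟨⟨trivial, trivial, trivial, trivial, trivial⟩, hv.symm, trivial, hu⟩
      · rw [if_neg he] at hv
        exact ⟨⟨trivial, trivial, trivial, trivial, trivial⟩, hv.symm, trivial, hu⟩
    · have hb' : ¬ s2.reg 9 = s2.reg 4 := hb
      rw [h9, h2.1.r4] at hb'
      have hc : ¬ (CorrectDiffArray (icr 1 u) ∧ icr 1 u (lastIdx n) = p) :=
        fun hc => hb' (if_pos hc)
      rw [if_neg hc]
      exact ⟨1, s2, by norm_num, .skip s2, h2⟩

theorem stepProg_runs (hk : 2 ≤ k) (hS : 4 * n ≤ S) (hW : 4 * n + 2 * k ≤ W)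
    {u : Fin n → ZMod k} {p : ZMod k} {s : State} (hg : Constants n k s.reg)
    (hp : s.reg 2 = p.val) (hu : ∀ x < n, s.mem x = periodicSeq u x) :
    Runs S W stepProg s (104 * n + 100)
      (Holds n k (transition (u, p)).1 (transition (u, p)).2) := by
  have hn := NeZero.pos n
  have hlast : icr 0 u (lastIdx n) = u 0 := by simp [icr_apply, lastIdx_add_one]
  refine ((shiftProg_runs hS hW hg hp hu).seq (m' := 5 + (49 * n + 31 + (49 * n + 51 + 1)))
    fun s1 h1 => ?_).mono (by omega) fun _ => id
  refine Runs.seq (m := 5) (R := fun s => Holds n k (icr 0 u) p s ∧ s.reg 7 = (p + 1).val)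
    ((runs_of_wp ?_).mono (by simp [Prog.block, Prog.cost]) fun _ => id) fun s2 ⟨h2, h7⟩ => ?_
  · obtain ⟨hg, hp, h8, hu⟩ := h1
    have hv := val_add_one_eq hk p
    have hlt := ZMod.val_lt p
    simp only [Holds, Prog.block, wp, Test.Holds, reg_setReg, mem_setReg, constants_iff,
      Nat.reduceEqDiff, if_true, if_false, hg.r0, hg.r1, hg.r4, hg.r5, hg.r6, hp, h8]
    refine ⟨by omega, fun he => ?_, fun he => ?_⟩
    · rw [if_pos he] at hv
      exact ⟨⟨⟨trivial, trivial, trivial, trivial, trivial⟩, trivial, trivial, hu⟩, hv.symm⟩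
    · rw [if_neg he] at hv
      exact ⟨⟨⟨trivial, trivial, trivial, trivial, trivial⟩, trivial, trivial, hu⟩, hv.symm⟩
  refine (condTestProg_runs hk hS hW h2 (P := icr 0 u (lastIdx n) = p + 1) ?_).seq
    fun s3 ⟨h3, h7', h9⟩ => Runs.seq (R := Holds n k (transition (u, p)).1 (transition (u, p)).2) ?_
      fun s4 h => ⟨1, s4, le_rfl, .skip s4, h⟩
  · show s2.reg 7 = s2.reg 8 ↔ _
    rw [h7, h2.2.2.1, (ZMod.val_injective k).eq_iff, eq_comm]
  refine Runs.ite (m := 49 * n + 50) (fun hb => ?_) fun hb => ?_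
  · have hb' : s3.reg 9 = s3.reg 4 := hb
    rw [h9, h3.1.r4] at hb'
    have hc : CorrectDiffArray (icr 0 u) ∧ icr 0 u (lastIdx n) = p + 1 := by
      by_contra hc
      rw [if_neg hc] at hb'
      exact zero_ne_one hb'
    refine (runs_of_wp ?_).mono (by simp [Prog.cost]) fun _ => id
    obtain ⟨hg, hp, h8, hu⟩ := h3
    unfold transition
    rw [if_pos hc]
    simp only [Holds, wp, reg_setReg, mem_setReg, constants_iff,
      Nat.reduceEqDiff, if_true, if_false, hg.r0, hg.r1, hg.r4, hg.r5, hg.r6, h8, h7', h7]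
    exact ⟨⟨trivial, trivial, trivial, trivial, trivial⟩, trivial, trivial, hu⟩
  · have hb' : ¬ s3.reg 9 = s3.reg 4 := hb
    rw [h9, h3.1.r4] at hb'
    have hc : ¬ (CorrectDiffArray (icr 0 u) ∧ icr 0 u (lastIdx n) = p + 1) :=
      fun hc => hb' (if_pos hc)
    refine (ascendProg_runs hk hS hW h3).mono le_rfl fun s h => ?_
    unfold transition
    rw [if_neg hc]
    split_ifs at h ⊢ with hc2
    · exact h
    · exact h

/-- Set register `3` to `0` if the string is `0 … 0`, and to `1` otherwise. -/
def zeroTestProg : Prog := .seq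
  (.block [.copy 3 5, .copy 10 5])
  (.while (.lt 10 0) (.block [.load 12 10, .add 10 10 4, .ite (.ne 12 5) (.copy 3 4) .skip]))

open Classical in
/-- The loop invariant of `zeroTestProg`. -/
def ZeroTestInv (u : Fin n → ZMod k) (p : ZMod k) (j : ℕ) (s : State) : Prop :=
  Holds n k u p s ∧ s.reg 10 = j ∧ s.reg 3 = if ∀ x < j, periodicSeq u x = 0 then 0 else 1

theorem zeroTestProg_runs (hS : 4 * n ≤ S) (hW : 4 * n + 2 * k ≤ W) {u : Fin n → ZMod k}
    {p : ZMod k} {s : State} (h : Holds n k u p s) :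
    Runs S W zeroTestProg s (7 * n + 4) fun s => Holds n k u p s ∧
      s.reg 3 = if u = fun _ => 0 then 0 else 1 := by
  classical
  have hn := NeZero.pos n
  have hp : Runs S W (.block [.copy 3 5, .copy 10 5]) s 3 (ZeroTestInv u p 0) := by
    obtain ⟨hg, hp, h8, hu⟩ := h
    refine (runs_of_wp ?_).mono (by simp [Prog.block, Prog.cost]) fun _ => id
    simp only [ZeroTestInv, Holds, Prog.block, wp, reg_setReg, mem_setReg, constants_iff,
      Nat.reduceEqDiff, if_true, if_false, hg.r0, hg.r1, hg.r4, hg.r5, hg.r6, hp, h8]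
    exact ⟨⟨⟨trivial, trivial, trivial, trivial, trivial⟩, trivial, trivial, hu⟩, trivial, by simp⟩
  refine (hp.seq fun s h => (Runs.loop (c := 6) (ZeroTestInv u p)
    (Nat.zero_le n) h (fun j s _ hj h => ⟨?_, ?_⟩) fun s h => ?_).mono le_rfl fun s h => ?_).mono
    (by omega) fun s h => h
  · show s.reg 10 < s.reg 0
    rw [h.2.1, h.1.1.r0]
    exact hj
  · obtain ⟨⟨hg, hp, h8, hu⟩, h10, h3⟩ := h
    refine (runs_of_wp ?_).mono (by simp [Prog.block, Prog.cost]) fun _ => id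
    simp only [ZeroTestInv, Holds, Prog.block, wp, Test.Holds, reg_setReg, mem_setReg,
      constants_iff, Nat.reduceEqDiff, if_true, if_false, hg.r0, hg.r1, hg.r4, hg.r5, hg.r6, hp,
      h8, h10, hu j hj, h3]
    refine ⟨by omega, by omega, fun hne => ?_, fun he => ?_⟩
    · refine ⟨⟨⟨trivial, trivial, trivial, trivial, trivial⟩, trivial, trivial, hu⟩, trivial, ?_⟩
      rw [if_neg fun hall => hne (hall j (Nat.lt_succ_self j))]
    · refine ⟨⟨⟨trivial, trivial, trivial, trivial, trivial⟩, trivial, trivial, hu⟩, trivial, ?_⟩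
      refine if_congr ⟨fun hall x hx => ?_, fun hall x hx => hall x (by omega)⟩ rfl rfl
      rcases Nat.eq_or_lt_of_le (Nat.le_of_lt_succ hx) with rfl | hlt
      · exact not_not.1 he
      · exact hall x hlt
  · show ¬ s.reg 10 < s.reg 0
    rw [h.2.1, h.1.1.r0]
    exact lt_irrefl _
  · refine ⟨h.1, h.2.2.trans (if_congr ⟨fun hall => ?_, fun hu x _ => ?_⟩ rfl rfl)⟩
    · funext x
      have := hall x.val x.isLt
      rwa [periodicSeq_val, ZMod.val_eq_zero] at this
    · rw [hu]; simp [periodicSeq]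

/-- Output the symbols one by one until the string is `0 … 0` again. -/
def mainLoop : Prog := .while (.eq 3 4) (.seq stepProg (.seq (.output 8) zeroTestProg))

/-- The generator of the words `icrWord n k`, on the input `(n, k)`. The registers `4`, `5`, `6` hold
the constants `1`, `0`, `n - 1`, register `2` holds the depth modulo `k`, and register `3` is `1` as
long as the loop continues. The string is in the cells `0, …, n - 1`. -/
def generator : Prog := .seq (.block [.const 4 1, .copy 3 4, .sub 6 0 4]) mainLoop

theorem visited_eq_zero_iff (hk : 2 ≤ k) {t : ℕ} (ht : 0 < t) (htN : t ≤ k ^ n) :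
    (visited n k t = fun _ => 0) ↔ t = k ^ n := by
  constructor
  · intro h
    have hper : Function.IsPeriodicPt next t (fun _ : Fin n => (0 : ZMod k)) := h
    have := Nat.le_of_dvd ht hper.minimalPeriod_dvd
    rw [minimalPeriod_next hk] at this
    omega
  · rintro rfl
    have := visited_periodic (n := n) hk 0
    rwa [zero_add] at this

/-- With `r` symbols to go, the loop outputs these symbols and halts. A step of the transition takes
at most `104 n + 100` steps and the final comparison with `0 … 0` at most `7 n + 4`; the bounds
`11 n` and `300 n` are generous. -/
theorem mainLoop_exec (hk : 2 ≤ k) (hS : 4 * n ≤ S) (hW : 4 * n + 2 * k ≤ W) (r : ℕ) :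
    ∀ (t : ℕ) (s : State), t + r = k ^ n → Constants n k s.reg →
      s.reg 2 = (depth (diffArray (visited n k t))).val →
      (∀ x < n, s.mem x = periodicSeq (visited n k t) x) → s.reg 3 = (if r = 0 then 0 else 1) →
      ∃ (l : List (Option ℕ)) (s' : State), Exec S W mainLoop s l s' ∧
        l.filterMap id =
          (List.range' t r).map (fun j => (visited n k (j + 1) (lastIdx n)).val) ∧
        Spaced (300 * n) (11 * n) l := by
  have hn := NeZero.pos n
  induction r with
  | zero =>
    intro t s _ hg _ _ h3
    refine ⟨[none], s, .whileFalse _ ?_, rfl, by omega, trivial⟩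
    show ¬ s.reg 3 = s.reg 4
    rw [h3, hg.r4]
    simp
  | succ r ih =>
    intro t s htr hg hp hu h3
    obtain ⟨a, s1, ha, he1, h1⟩ := stepProg_runs hk hS hW hg hp hu
    have htrans := transition_withDepth (visited n k t)
    rw [← visited_succ] at htrans
    unfold withDepth at htrans
    rw [htrans] at h1
    obtain ⟨b, s2, hb, he2, h2, h32⟩ := zeroTestProg_runs hS hW h1
    obtain ⟨l, s3, he3, hout, hsp⟩ := ih (t + 1) s2 (by omega) h2.1 h2.2.1 h2.2.2.2 (by
      rw [h32]
      refine if_congr ?_ rfl rfl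
      rw [visited_eq_zero_iff hk (Nat.succ_pos t) (by omega)]
      omega)
    refine ⟨_, s3, .whileTrue ?_ (.seq he1 (.seq (.output s1 8) he2)) he3, ?_, ?_⟩
    · show s.reg 3 = s.reg 4
      rw [h3, hg.r4]
      simp
    · simp [List.range'_succ, h1.2.2.1]
      exact hout
    · refine ⟨by omega, ?_⟩
      rw [List.append_assoc]
      refine spaced_replicate ?_ (by omega)
      show Spaced (300 * n) 0 (List.replicate b none ++ l)
      exact spaced_replicate (hsp.mono (by omega)) (by omega)

theorem generator_generates (hk : 2 ≤ k) :
    Generates generator n k (300 * n) (300 * (n + k)) (300 * n) (icrWord n k) := by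
  have hn := NeZero.pos n
  have hN : k ^ n ≠ 0 := pow_ne_zero _ (NeZero.ne k)
  have hinit : Runs (300 * n) (300 * (n + k)) (.block [.const 4 1, .copy 3 4, .sub 6 0 4])
      (inputState n k) 4 fun s => Constants n k s.reg ∧ s.reg 2 = 0 ∧ s.reg 3 = 1 ∧
        ∀ x, s.mem x = 0 := by
    refine (runs_of_wp ?_).mono (by simp [Prog.block, Prog.cost]) fun _ => id
    simp [Prog.block, wp, reg_setReg, mem_setReg, constants_iff, inputState]
    omega
  obtain ⟨a, s, ha, he, hg, h2, h3, hm⟩ := hinit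
  obtain ⟨l, s', he', hout, hsp⟩ := mainLoop_exec (n := n) (k := k) (S := 300 * n)
    (W := 300 * (n + k)) hk (by omega) (by omega) (k ^ n) 0 s (by omega) hg
    (by rw [h2]; simp [visited, depth_zero])
    (fun x _ => by rw [hm]; simp [visited, periodicSeq]) (by rw [h3, if_neg hN])
  refine ⟨_, s', .seq he he', ?_, fun u hu hlen => ?_⟩
  · have hnone : (List.replicate a (none : Option ℕ)).filterMap id = [] := by simp
    rw [List.filterMap_append, hnone, hout]
    exact List.ext_getElem (by simp) fun i h1 h2 => by simp [icrWord_apply]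
  · refine Spaced.infix (c := 0) (by omega) (spaced_replicate (hsp.mono ?_) ?_) hu hlen
    · omega
    · omega

end Program

end DeBruijn

theorem theorem1 :
    -- the construction yields de Bruijn sequences of small discrepancy
    (∀ (n k : ℕ) [NeZero n] [NeZero k], 2 ≤ k →
      DeBruijn.IsDeBruijn n (DeBruijn.icrWord n k) ∧
      (k = 2 → DeBruijn.discrepancy (DeBruijn.icrWord n k) = n) ∧
      (2 < k → DeBruijn.discrepancy (DeBruijn.icrWord n k) ≤ n + 1)) ∧
    -- one program generates them all, with linear memory and linear time per symbol
    (∃ (p : DeBruijn.Prog) (C : ℕ), ∀ (n k : ℕ) [NeZero n] [NeZero k], 2 ≤ k →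
      DeBruijn.Generates p n k (C * n) (C * (n + k)) (C * n) (DeBruijn.icrWord n k)) ∧
    -- `n` is a lower bound over every alphabet
    (∀ (n k N : ℕ) [NeZero n] [NeZero k], 2 ≤ k → ∀ w : Fin N → ZMod k,
      DeBruijn.IsDeBruijn n w → n ≤ DeBruijn.discrepancy w) ∧
    -- `n` is the minimum discrepancy of a binary de Bruijn sequence
    (∀ n : ℕ, 0 < n →
      IsLeast {d : ℕ | ∃ (N : ℕ) (w : Fin N → ZMod 2),
        DeBruijn.IsDeBruijn n w ∧ DeBruijn.discrepancy w = d} n) := by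
  refine ⟨fun n k _ _ hk => ⟨DeBruijn.isDeBruijn_icrWord hk, ?_,
    fun _ => DeBruijn.discrepancy_icrWord_le hk⟩,
    ⟨DeBruijn.generator, 300, fun n k _ _ hk => DeBruijn.generator_generates hk⟩,
    fun n k N _ _ hk w hw => DeBruijn.le_discrepancy hk hw, fun n hn => ?_⟩
  · rintro rfl
    exact DeBruijn.discrepancy_icrWord_two
  · have : NeZero n := ⟨hn.ne'⟩
    refine ⟨⟨2 ^ n, DeBruijn.icrWord n 2, DeBruijn.isDeBruijn_icrWord le_rfl,
      DeBruijn.discrepancy_icrWord_two⟩, ?_⟩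
    rintro d ⟨N, w, hw, rfl⟩
    exact DeBruijn.le_discrepancy le_rfl hw
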